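/- Let $\mathbb{T}^2=(\mathbb{R}/\mathbb{Z})^2$ and, for $s\in\mathbb{R}$, let $\|\cdot\|_s$ be the norm of the $L^2$-Sobolev space $H^s$ on $\mathbb{T}^2$, $\|u\|_s^2=\sum_{k\in\mathbb{Z}^2}(1+4\pi^2|k|^2)^s|\hat u(k)|^2$, summed over the components when $u$ is vector- or matrix-valued. Let $x^0:\mathbb{T}^2\to\mathbb{R}^5$ be a $C^\infty$ map and let $g^0=(g^0_{ij})_{1\le i,j\le 2}$ be a $C^\infty$ matrix-valued function on $\mathbb{T}^2$ such that $$\Big(\frac{\partial x^0}{\partial\theta_i},\frac{\partial x^0}{\partial\theta_j}\Big)=g^0_{ij}\quad\text{on }\mathbb{T}^2,\ i,j\in\{1,2\},$$ where $(\cdot,\cdot)$ is the Euclidean inner product of $\mathbb{R}^5$. Suppose that $$\det\Big(\frac{\partial x^0}{\partial\theta_1},\frac{\partial x^0}{\partial\theta_2},\frac{\partial^2x^0}{\partial\theta_1^2},\frac{\partial^2x^0}{\partial\theta_1\partial\theta_2},\frac{\partial^2x^0}{\partial\theta_2^2}\Big)\neq0\quad\text{at every point of }\mathbb{T}^2.$$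 Then for all real numbers $\delta>\mu>3$ and $\alpha<\delta-\mu$ there are $\rho>0$ and $C>0$ such that, for every symmetric $g=(g_{ij})\in H^{\delta+\mu-1}(\mathbb{T}^2;\mathbb{R}^{2\times2})$ with $\|g-g^0\|_{\delta+\mu-1}\le\rho$, there is a map $x:\mathbb{T}^2\to\mathbb{R}^5$ of class $C^2$, with $x\in H^{\mu}\cap H^{\alpha+\mu}$, such that $$\Big(\frac{\partial x}{\partial\theta_i},\frac{\partial x}{\partial\theta_j}\Big)=g_{ij}\ \text{ almost everywhere on }\mathbb{T}^2\ (i,j\in\{1,2\}),\qquad \|x-x^0\|_\mu\le1,\qquad \|x-x^0\|_{\mu+\alpha}\le C\,\|g-g^0\|_{\mu+\delta-1}$$ (the first identity holds everywhere if $g$ is continuous). -/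

import Mathlib

open scoped ContDiff

noncomputable section

namespace TorusIsometric

/-- The two-dimensional torus `(ℝ / ℤ)²`. -/
abbrev T2 : Type := UnitAddTorus (Fin 2)

/-- Five-dimensional Euclidean space. -/
abbrev E5 : Type := EuclideanSpace ℝ (Fin 5)

/-- The `ℤ²`-periodic function on `ℝ²` that corresponds to a function on the torus. -/
def lift {E : Type*} (u : T2 → E) : (Fin 2 → ℝ) → E :=
  fun p => u (fun i => (p i : UnitAddCircle))

/-- A function on the torus is of class `C^n` if the periodic function on the plane is. -/
def IsC {E : Type*} [NormedAddCommGroup E] [NormedSpace ℝ E] (n : ℕ∞) (u : T2 → E) : Prop :=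
  ContDiff ℝ n (lift u)

/-- The classical partial derivative `∂u/∂θ_i` of a function on the torus. -/
def pd {E : Type*} [NormedAddCommGroup E] [NormedSpace ℝ E] (i : Fin 2) (u : T2 → E) : T2 → E :=
  fun θ => deriv (fun t : ℝ => u (θ + Pi.single i (t : UnitAddCircle))) 0

/-- The normalized Haar (Lebesgue) measure on the torus. -/
def torusMeasure : MeasureTheory.Measure T2 :=
  MeasureTheory.Measure.pi (fun _ : Fin 2 => (AddCircle.haarAddCircle : MeasureTheory.Measure _))

/-- The term of index `k` in the squared `H^s` norm: `(1 + 4π²|k|²)^s |û(k)|²`. -/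
def sobolevTerm (s : ℝ) (u : T2 → ℝ) (k : Fin 2 → ℤ) : ℝ :=
  (1 + 4 * Real.pi ^ 2 * ∑ i, (k i : ℝ) ^ 2) ^ s *
    ‖UnitAddTorus.mFourierCoeff (fun θ => (u θ : ℂ)) k‖ ^ 2

/-- The family `u = (u_a)` of real functions belongs to `H^s`: every `u_a` is square-integrable and
`∑_k (1 + 4π²|k|²)^s |û_a(k)|² < ∞`. (For `s < 0` this is `L² ∩ H^s = L²`.) -/
def MemH {ι : Type*} (s : ℝ) (u : ι → T2 → ℝ) : Prop :=
  ∀ a, MeasureTheory.MemLp (u a) 2 torusMeasure ∧ Summable (sobolevTerm s (u a))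

/-- The `H^s` norm of a finite family `u = (u_a)` of real functions:
the square root of `∑_a ∑_k (1 + 4π²|k|²)^s |û_a(k)|²`. -/
def normH {ι : Type*} [Fintype ι] (s : ℝ) (u : ι → T2 → ℝ) : ℝ :=
  Real.sqrt (∑ a, ∑' k, sobolevTerm s (u a) k)

/-- The five coordinate functions of a map into `ℝ⁵`. -/
def coords (x : T2 → E5) : Fin 5 → T2 → ℝ :=
  fun a θ => x θ a

/-- The four entries of a matrix-valued function. -/
def entries (g : T2 → Matrix (Fin 2) (Fin 2) ℝ) : Fin 2 × Fin 2 → T2 → ℝ :=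
  fun p θ => g θ p.1 p.2

/-- The matrix of the first derivatives `∂₁x`, `∂₂x` and the second derivatives
`∂₁∂₁x`, `∂₁∂₂x`, `∂₂∂₂x`, as its five rows. -/
def oscMatrix (x : T2 → E5) (θ : T2) : Matrix (Fin 5) (Fin 5) ℝ :=
  Matrix.of fun r c =>
    (![pd 0 x θ, pd 1 x θ, pd 0 (pd 0 x) θ, pd 0 (pd 1 x) θ, pd 1 (pd 1 x) θ] r : E5) c

/-- The metric `((∂x/∂θ_i, ∂x/∂θ_j))_{i,j}` induced by a map `x` into `ℝ⁵`. -/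
def inducedMetric (x : T2 → E5) (θ : T2) : Matrix (Fin 2) (Fin 2) ℝ :=
  Matrix.of fun i j => inner ℝ (pd i x θ) (pd j x θ)

end TorusIsometric

end

noncomputable section

namespace TorusIsometric

open UnitAddTorus MeasureTheory Complex ComplexConjugate

/-! Write x = x⁰ + v and h = g − g⁰. The equation to solve is ∂_i x⁰·∂_j v + ∂_j x⁰·∂_i v + ∂_i
v·∂_j v = h_ij, and solving it directly for v loses derivatives in the quadratic term. Günther's
identity removes the loss: ∂_i v·∂_j v = −∂_i N_j − ∂_j N_i + 2 N_ij, where N_j = (1−Δ)⁻¹(Δv·∂_j v)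
and N_ij = −½(1−Δ)⁻¹(2 ∑_l ∂_i∂_l v·∂_j∂_l v − 2 Δv·∂_i∂_j v − ∂_i v·∂_j v). It then suffices that
∂_i x⁰·v = N_i and ∂_i∂_j x⁰·v = −½ h_ij + N_ij. These are five pointwise linear equations for the
five components of v, with matrix `oscMatrix x⁰`, invertible by hypothesis. Hence v = M(η + N(v,v))
with N bilinear of order zero, and for small h the contraction principle applies
(`gunther_antisymm`, `symbolBound_guntherSym`, `exists_wiener_fixedPoint`, `exists_perturbation`).

The analysis is done on Fourier coefficients, in ℓ¹ with weight (1+4π²|k|²)^t, t = δ/2. This space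
is a convolution algebra, on which N acts as a convolution twisted by an explicit symbol, bounded as
soon as t ≥ 1. Cauchy–Schwarz sends H^{δ+μ−1} into it (`inWiener_and_wienerNorm_le`), and ℓ¹ ⊂ ℓ²
sends it into H^r for every r ≤ δ (`summable_sobolevTerm_and_tsum_le`). The gap between the Sobolev
exponents of data and solution pays for both embeddings. -/

/-- Frequencies of Fourier series on the torus. -/
abbrev Freq : Type := Fin 2 → ℤ

/-! ### Weights and derivative symbols on ℤ². -/

/-- The symbol `1 + 4π²|k|²` of the operator `1 - Δ`. -/
def japSq (k : Freq) : ℝ := 1 + 4 * Real.pi ^ 2 * ∑ i, (k i : ℝ) ^ 2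

lemma one_le_japSq (k : Freq) : 1 ≤ japSq k := by
  unfold japSq
  have : 0 ≤ 4 * Real.pi ^ 2 * ∑ i, (k i : ℝ) ^ 2 := by positivity
  linarith

lemma japSq_pos (k : Freq) : 0 < japSq k := one_pos.trans_le (one_le_japSq k)

lemma japSq_rpow_pos (k : Freq) (t : ℝ) : 0 < japSq k ^ t := Real.rpow_pos_of_pos (japSq_pos k) t

lemma japSq_neg (k : Freq) : japSq (-k) = japSq k := by simp [japSq]

/-- The claim reduces to p·q ≤ 2π²|p|²|q|², which fails for small real vectors; integrality gives ab
≤ a²b² for each product of coordinates. Having constant 1 makes the weighted ℓ¹ spaces Banach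
algebras without renorming. -/
lemma japSq_add_le (p q : Freq) : japSq (p + q) ≤ japSq p * japSq q := by
  have key (a b : ℤ) : (a : ℝ) * b ≤ a ^ 2 * b ^ 2 := by
    have : a * b ≤ a ^ 2 * b ^ 2 := by rw [← mul_pow]; exact Int.le_self_sq _
    exact_mod_cast this
  have h0 := key (p 0) (q 0)
  have h1 := key (p 1) (q 1)
  have hpi : 1 ≤ Real.pi ^ 2 := by nlinarith [Real.pi_gt_three]
  simp only [japSq, Fin.sum_univ_two, Pi.add_apply, Int.cast_add]
  set a := (p 0 : ℝ)
  set b := (p 1 : ℝ)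
  set c := (q 0 : ℝ)
  set d := (q 1 : ℝ)
  have e1 : a * c + b * d ≤ (a ^ 2 + b ^ 2) * (c ^ 2 + d ^ 2) := by
    nlinarith [mul_nonneg (sq_nonneg a) (sq_nonneg d), mul_nonneg (sq_nonneg b) (sq_nonneg c)]
  have e2 : 0 ≤ (a ^ 2 + b ^ 2) * (c ^ 2 + d ^ 2) := by positivity
  have e3 : (a ^ 2 + b ^ 2) * (c ^ 2 + d ^ 2) ≤
      Real.pi ^ 2 * ((a ^ 2 + b ^ 2) * (c ^ 2 + d ^ 2)) := le_mul_of_one_le_left e2 hpi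
  have e4 : 0 ≤ Real.pi ^ 2 * (Real.pi ^ 2 * ((a ^ 2 + b ^ 2) * (c ^ 2 + d ^ 2))
      - (a * c + b * d)) := mul_nonneg (by positivity) (by linarith)
  have e5 : 0 ≤ Real.pi ^ 2 * (Real.pi ^ 2 * ((a ^ 2 + b ^ 2) * (c ^ 2 + d ^ 2))) := by
    positivity
  nlinarith

lemma japSq_add_rpow_le (p q : Freq) {t : ℝ} (ht : 0 ≤ t) :
    japSq (p + q) ^ t ≤ japSq p ^ t * japSq q ^ t := by
  rw [← Real.mul_rpow (japSq_pos p).le (japSq_pos q).le]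
  exact Real.rpow_le_rpow (japSq_pos _).le (japSq_add_le p q) ht

lemma norm_sq_le_japSq (k : Freq) : ‖k‖ ^ 2 ≤ japSq k := by
  have hpi : 1 ≤ Real.pi ^ 2 := by nlinarith [Real.pi_gt_three]
  have h : ‖k‖ ≤ Real.sqrt (japSq k) := by
    refine (pi_norm_le_iff_of_nonneg (Real.sqrt_nonneg _)).2 fun i => ?_
    refine Real.le_sqrt_of_sq_le ?_
    rw [Int.norm_eq_abs, sq_abs, japSq]
    have : (k i : ℝ) ^ 2 ≤ ∑ i, (k i : ℝ) ^ 2 :=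
      Finset.single_le_sum (f := fun i => (k i : ℝ) ^ 2) (fun _ _ => sq_nonneg _)
        (Finset.mem_univ i)
    nlinarith [sq_nonneg (k i : ℝ)]
  calc ‖k‖ ^ 2 ≤ Real.sqrt (japSq k) ^ 2 := by gcongr
    _ = japSq k := Real.sq_sqrt (japSq_pos k).le

lemma summable_japSq_rpow_neg {s : ℝ} (hs : 1 < s) : Summable fun k : Freq => japSq k ^ (-s) := by
  have h := EisensteinSeries.summable_one_div_norm_rpow (k := 2 * s) (by linarith)
  refine Summable.of_norm_bounded_eventually h ?_
  filter_upwards [(Set.finite_singleton (0 : Freq)).compl_mem_cofinite] with k hk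
  have hk' : 0 < ‖k‖ := norm_pos_iff.2 hk
  rw [Real.norm_of_nonneg (japSq_rpow_pos _ _).le,
    show -(2 * s) = 2 * (-s) by ring, Real.rpow_mul hk'.le]
  refine Real.rpow_le_rpow_of_nonpos (by positivity) ?_ (by linarith)
  simpa using norm_sq_le_japSq k

/-- The symbol of the partial derivative `∂/∂θ_i`. -/
def dsym (i : Fin 2) (k : Freq) : ℂ := 2 * Real.pi * I * k i

lemma dsym_add (i : Fin 2) (p q : Freq) : dsym i (p + q) = dsym i p + dsym i q := by
  simp [dsym]; ring

lemma dsym_neg (i : Fin 2) (p : Freq) : dsym i (-p) = conj (dsym i p) := by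
  simp [dsym, Complex.conj_ofNat]

lemma japSq_eq (k : Freq) : (japSq k : ℂ) = 1 - dsym 0 k ^ 2 - dsym 1 k ^ 2 := by
  simp only [japSq, dsym, Fin.sum_univ_two]
  push_cast
  linear_combination (4 * (Real.pi : ℂ) ^ 2 * ((k 0 : ℂ) ^ 2 + (k 1 : ℂ) ^ 2)) * I_sq

lemma norm_dsym_sq_le (i : Fin 2) (k : Freq) : ‖dsym i k‖ ^ 2 ≤ japSq k := by
  have : ‖dsym i k‖ ^ 2 = 4 * Real.pi ^ 2 * (k i : ℝ) ^ 2 := by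
    simp [dsym, mul_pow]; norm_num
  rw [this, japSq]
  have : (k i : ℝ) ^ 2 ≤ ∑ i, (k i : ℝ) ^ 2 :=
    Finset.single_le_sum (f := fun i => (k i : ℝ) ^ 2) (fun _ _ => sq_nonneg _)
      (Finset.mem_univ i)
  have := mul_le_mul_of_nonneg_left this (show 0 ≤ 4 * Real.pi ^ 2 by positivity)
  linarith

lemma norm_dsym_mul_le (i j : Fin 2) (k : Freq) : ‖dsym i k * dsym j k‖ ≤ japSq k := by
  rw [norm_mul]
  nlinarith [norm_dsym_sq_le i k, norm_dsym_sq_le j k, sq_nonneg (‖dsym i k‖ - ‖dsym j k‖)]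

/-- Wasteful by a square root: a first derivative is charged a full power of the weight. This is
affordable because the solution is sought with `t ≥ 1`. -/
lemma norm_dsym_le (i : Fin 2) (k : Freq) : ‖dsym i k‖ ≤ japSq k := by
  nlinarith [norm_dsym_sq_le i k, one_le_japSq k, norm_nonneg (dsym i k)]

/-! ### Weighted Wiener spaces and Hermitian sequences. -/

/-- The sequences with `∑ (1 + 4π²|k|²)^t |c_k| < ∞`. -/
def InWiener (t : ℝ) (c : Freq → ℂ) : Prop := Summable fun k => japSq k ^ t * ‖c k‖

/-- The weighted `ℓ¹` norm `∑ (1 + 4π²|k|²)^t |c_k|`. -/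
def wienerNorm (t : ℝ) (c : Freq → ℂ) : ℝ := ∑' k, japSq k ^ t * ‖c k‖

lemma wienerNorm_nonneg (t : ℝ) (c : Freq → ℂ) : 0 ≤ wienerNorm t c :=
  tsum_nonneg fun k => mul_nonneg (japSq_rpow_pos k t).le (norm_nonneg _)

lemma InWiener.mono {s t : ℝ} (h : s ≤ t) {c : Freq → ℂ} (hc : InWiener t c) : InWiener s c :=
  hc.of_nonneg_of_le (fun k => mul_nonneg (japSq_rpow_pos k s).le (norm_nonneg _)) fun k =>
    mul_le_mul_of_nonneg_right (Real.rpow_le_rpow_of_exponent_le (one_le_japSq k) h)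
      (norm_nonneg _)

lemma InWiener.summable_norm {t : ℝ} (ht : 0 ≤ t) {c : Freq → ℂ} (hc : InWiener t c) :
    Summable fun k => ‖c k‖ := by
  simpa [InWiener] using hc.mono ht

lemma InWiener.add {t : ℝ} {c d : Freq → ℂ} (hc : InWiener t c) (hd : InWiener t d) :
    InWiener t (fun k => c k + d k) :=
  (Summable.add hc hd).of_nonneg_of_le
    (fun k => mul_nonneg (japSq_rpow_pos k t).le (norm_nonneg _)) fun k => by
      rw [← mul_add]
      exact mul_le_mul_of_nonneg_left (norm_add_le _ _) (japSq_rpow_pos k t).le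

lemma InWiener.const_mul {t : ℝ} {c : Freq → ℂ} (hc : InWiener t c) (a : ℂ) :
    InWiener t (fun k => a * c k) := by
  refine (Summable.mul_left ‖a‖ hc).congr fun k => ?_
  rw [norm_mul]; ring

lemma InWiener.sum {ι : Type*} (s : Finset ι) {t : ℝ} {c : ι → Freq → ℂ}
    (hc : ∀ a, InWiener t (c a)) : InWiener t (fun k => ∑ a ∈ s, c a k) := by
  classical
  induction s using Finset.induction_on with
  | empty => simp [InWiener]
  | insert a s ha ih =>
    simp only [Finset.sum_insert ha]
    exact (hc a).add ih

lemma InWiener.dsym_mul {t : ℝ} {c : Freq → ℂ} (hc : InWiener (t + 1) c) (i : Fin 2) :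
    InWiener t (fun k => dsym i k * c k) := by
  refine hc.of_nonneg_of_le
    (fun k => mul_nonneg (japSq_rpow_pos k t).le (norm_nonneg _)) fun k => ?_
  rw [norm_mul, Real.rpow_add (japSq_pos k), Real.rpow_one, mul_assoc]
  have := norm_dsym_le i k
  have := japSq_rpow_pos k t
  gcongr

/-- The sequences of Fourier coefficients of real functions. -/
def IsHermSeq (c : Freq → ℂ) : Prop := ∀ k, c (-k) = conj (c k)

lemma IsHermSeq.add {c d : Freq → ℂ} (hc : IsHermSeq c) (hd : IsHermSeq d) :
    IsHermSeq (fun k => c k + d k) := fun k => by simp [hc k, hd k]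

lemma IsHermSeq.sum {ι : Type*} (s : Finset ι) {c : ι → Freq → ℂ}
    (hc : ∀ a, IsHermSeq (c a)) : IsHermSeq (fun k => ∑ a ∈ s, c a k) := fun k => by
  simp [fun a => hc a k]

/-! ### Sums of absolutely convergent Fourier series -/

/-- The sum of the Fourier series with coefficients `c`. -/
def synth (c : Freq → ℂ) (θ : T2) : ℂ := ∑' k, c k * mFourier k θ

lemma norm_mFourier_apply (k : Freq) (θ : T2) : ‖mFourier k θ‖ = 1 := by
  simp only [mFourier, fourier_apply, ContinuousMap.coe_mk, norm_prod, Circle.norm_coe,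
    Finset.prod_const_one]

lemma summable_synth {c : Freq → ℂ} (hc : Summable fun k => ‖c k‖) (θ : T2) :
    Summable fun k => c k * mFourier k θ :=
  .of_norm (by simpa [norm_mFourier_apply] using hc)

lemma continuous_synth {c : Freq → ℂ} (hc : Summable fun k => ‖c k‖) :
    Continuous (synth c) :=
  continuous_tsum (fun k => by fun_prop) hc fun k θ => by simp [norm_mFourier_apply]

lemma synth_add {c d : Freq → ℂ} (hc : Summable fun k => ‖c k‖) (hd : Summable fun k => ‖d k‖)
    (θ : T2) : synth (fun k => c k + d k) θ = synth c θ + synth d θ := by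
  simp only [synth, add_mul]
  exact (summable_synth hc θ).tsum_add (summable_synth hd θ)

lemma synth_const_mul (a : ℂ) (c : Freq → ℂ) (θ : T2) :
    synth (fun k => a * c k) θ = a * synth c θ := by
  simp only [synth, mul_assoc]
  exact tsum_mul_left

lemma synth_sum {ι : Type*} (s : Finset ι) {c : ι → Freq → ℂ}
    (hc : ∀ a, Summable fun k => ‖c a k‖) (θ : T2) :
    synth (fun k => ∑ a ∈ s, c a k) θ = ∑ a ∈ s, synth (c a) θ := by
  simp only [synth, Finset.sum_mul]
  exact Summable.tsum_finsetSum fun a _ => summable_synth (hc a) θ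

lemma conj_synth {c : Freq → ℂ} (hc : IsHermSeq c) (θ : T2) :
    conj (synth c θ) = synth c θ := by
  simp only [synth]
  rw [Complex.conj_tsum, ← (Equiv.neg Freq).tsum_eq]
  refine tsum_congr fun k => ?_
  simp [mFourier_neg, hc k]

lemma ofReal_synth_re {c : Freq → ℂ} (hc : IsHermSeq c) (θ : T2) :
    (((synth c θ).re : ℝ) : ℂ) = synth c θ :=
  Complex.conj_eq_iff_re.1 (conj_synth hc θ)

lemma mFourier_mk (k : Freq) (p : Fin 2 → ℝ) :
    mFourier k (fun i => (p i : UnitAddCircle)) = exp (∑ i, dsym i k * p i) := by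
  simp only [mFourier, ContinuousMap.coe_mk, fourier_coe_apply, exp_sum, dsym]
  simp

lemma mFourier_add_apply (k : Freq) (θ φ : T2) :
    mFourier k (θ + φ) = mFourier k θ * mFourier k φ := by
  simp [mFourier, fourier_apply, smul_add, AddCircle.toCircle_add]
  ring

lemma mFourier_single_apply (k : Freq) (i : Fin 2) (t : ℝ) :
    mFourier k (Pi.single i (t : UnitAddCircle)) = exp (dsym i k * t) := by
  have : (Pi.single i (t : UnitAddCircle) : T2)
      = fun j => ((Pi.single i t : Fin 2 → ℝ) j : UnitAddCircle) := by
    funext j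
    by_cases h : j = i
    · subst h; simp
    · simp [h]
  rw [this, mFourier_mk]
  congr 1
  rw [Finset.sum_eq_single i] <;> simp +contextual

lemma hasDerivAt_synth {c : Freq → ℂ} (hc : InWiener 1 c) (i : Fin 2) (θ : T2) :
    HasDerivAt (fun t : ℝ => synth c (θ + Pi.single i (t : UnitAddCircle)))
      (synth (fun k => dsym i k * c k) θ) 0 := by
  have hexp (k : Freq) (t : ℝ) : ‖exp (dsym i k * t)‖ = 1 := by
    rw [show dsym i k * t = ((2 * Real.pi * k i * t : ℝ) : ℂ) * I by
      simp [dsym]; ring]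
    exact norm_exp_ofReal_mul_I _
  have h := hasDerivAt_tsum (𝕜 := ℝ) (y₀ := 0) (u := fun k => japSq k ^ (1 : ℝ) * ‖c k‖)
    (g := fun (k : Freq) (t : ℝ) => c k * (mFourier k θ * exp (dsym i k * t)))
    (g' := fun (k : Freq) (t : ℝ) =>
      c k * (mFourier k θ * (exp (dsym i k * t) * (dsym i k * 1)))) hc ?_ ?_ ?_ 0
  · have e : synth (fun k => dsym i k * c k) θ = ∑' k : Freq,
        c k * (mFourier k θ * (exp (dsym i k * (0 : ℝ)) * (dsym i k * 1))) :=
      tsum_congr fun k => by simp; ring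
    rw [e]
    simp only [synth, mFourier_add_apply, mFourier_single_apply]
    exact h
  · intro k t
    have := (((ofRealCLM.hasDerivAt (x := t)).const_mul (dsym i k)).cexp).const_mul (mFourier k θ)
    exact this.const_mul (c k)
  · intro k t
    rw [norm_mul, norm_mul, norm_mul, hexp, norm_mFourier_apply, Real.rpow_one]
    simp only [mul_one, one_mul]
    rw [mul_comm]
    have := norm_dsym_le i k
    gcongr
  · simpa using summable_synth (hc.summable_norm zero_le_one) θ

lemma iteratedDeriv_const_mul_cexp_I (a : ℂ) (n : ℕ) :
    iteratedDeriv n (fun s : ℝ => a * exp (I * s)) = fun s : ℝ => a * I ^ n * exp (I * s) := by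
  induction n with
  | zero => simp
  | succ n ih =>
    rw [iteratedDeriv_succ, ih]
    funext s
    have := (((ofRealCLM.hasDerivAt (x := s)).const_mul I).cexp).const_mul (a * I ^ n)
    convert! this.deriv using 1
    simp; ring

/-- One power of the weight is worth two derivatives, so the series may be differentiated twice term
by term. -/
lemma contDiff_lift_synth {c : Freq → ℂ} (hc : InWiener 1 c) :
    ContDiff ℝ 2 (lift (synth c)) := by
  -- Each term is a function of one real variable composed with a linear form, so its iterated
  -- derivatives are bounded by powers of ‖L k‖.
  let L (k : Freq) : (Fin 2 → ℝ) →L[ℝ] ℝ :=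
    ∑ i, (2 * Real.pi * (k i : ℝ)) • ContinuousLinearMap.proj (R := ℝ) (φ := fun _ => ℝ) i
  let f (k : Freq) (s : ℝ) : ℂ := c k * exp (I * s)
  have hf (k : Freq) : ContDiff ℝ (2 : ℕ∞) (f k) := by
    have : ContDiff ℝ (2 : ℕ∞) (fun s : ℝ => (s : ℂ)) := ofRealCLM.contDiff
    exact contDiff_const.mul ((contDiff_const.mul this).cexp)
  have hL (k : Freq) : ‖L k‖ ^ 2 ≤ 2 * japSq k := by
    have h1 : ‖L k‖ ≤ 2 * Real.pi * (|(k 0 : ℝ)| + |(k 1 : ℝ)|) := by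
      refine (L k).opNorm_le_bound (by positivity) fun p => ?_
      simp only [L, Fin.sum_univ_two, add_apply,
        smul_apply, ContinuousLinearMap.proj_apply, smul_eq_mul]
      refine (norm_add_le _ _).trans ?_
      simp only [norm_mul, Real.norm_eq_abs, abs_of_pos Real.pi_pos, abs_two]
      have h0 : |p 0| ≤ ‖p‖ := norm_le_pi_norm p 0
      have h1 : |p 1| ≤ ‖p‖ := norm_le_pi_norm p 1
      have e0 : 2 * Real.pi * |(k 0 : ℝ)| * |p 0| ≤ 2 * Real.pi * |(k 0 : ℝ)| * ‖p‖ := by gcongr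
      have e1 : 2 * Real.pi * |(k 1 : ℝ)| * |p 1| ≤ 2 * Real.pi * |(k 1 : ℝ)| * ‖p‖ := by gcongr
      linarith
    have h2 : ‖L k‖ ^ 2 ≤ (2 * Real.pi * (|(k 0 : ℝ)| + |(k 1 : ℝ)|)) ^ 2 := by gcongr
    have h3 : (|(k 0 : ℝ)| + |(k 1 : ℝ)|) ^ 2 ≤ 2 * ((k 0 : ℝ) ^ 2 + (k 1 : ℝ) ^ 2) := by
      nlinarith [sq_abs (k 0 : ℝ), sq_abs (k 1 : ℝ), sq_nonneg (|(k 0 : ℝ)| - |(k 1 : ℝ)|)]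
    have h4 := mul_le_mul_of_nonneg_left h3 (show 0 ≤ 4 * Real.pi ^ 2 by positivity)
    simp only [japSq, Fin.sum_univ_two]
    nlinarith
  have hJ (k : Freq) := one_le_japSq k
  have heq : lift (synth c) = fun p => ∑' k, (f k ∘ L k) p := by
    funext p
    simp only [lift, synth, mFourier_mk]
    refine tsum_congr fun k => ?_
    simp only [f, L, Function.comp_apply, Fin.sum_univ_two, add_apply,
      smul_apply, ContinuousLinearMap.proj_apply, smul_eq_mul, dsym]
    push_cast
    congr 2
    ring
  rw [heq]
  refine contDiff_tsum (N := (2 : ℕ∞)) (v := fun _ k => 2 * (japSq k ^ (1 : ℝ) * ‖c k‖))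
    (fun k => (hf k).comp (L k).contDiff) (fun _ _ => Summable.mul_left 2 hc) ?_
  intro n k p hn
  have hn' : n ≤ 2 := by exact_mod_cast hn
  rw [(L k).iteratedFDeriv_comp_right (hf k) p (by exact_mod_cast hn)]
  refine (ContinuousMultilinearMap.norm_compContinuousLinearMap_le _ _).trans ?_
  rw [norm_iteratedFDeriv_eq_norm_iteratedDeriv, iteratedDeriv_const_mul_cexp_I]
  have hexp : ‖exp (I * (L k p : ℝ))‖ = 1 := by
    rw [mul_comm]; exact norm_exp_ofReal_mul_I _
  simp only [norm_mul, norm_pow, norm_I, one_pow, mul_one, hexp, Finset.prod_const,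
    Finset.card_univ, Fintype.card_fin, Real.rpow_one]
  have : ‖L k‖ ^ n ≤ 2 * japSq k := by
    interval_cases n
    · simp; linarith [hJ k]
    · nlinarith [hL k, hJ k, norm_nonneg (L k)]
    · exact hL k
  nlinarith [norm_nonneg (c k)]

/-! ### Twisted convolutions -/

/-- The convolution of `c` and `d` twisted by the symbol `σ`. -/
def conv (σ : Freq → Freq → ℂ) (c d : Freq → ℂ) (k : Freq) : ℂ :=
  ∑' p, σ p (k - p) * (c p * d (k - p))

/-- The bijection `(k, p) ↦ (p, k - p)`. -/
def splitEquiv : Freq × Freq ≃ Freq × Freq where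
  toFun x := (x.2, x.1 - x.2)
  invFun x := (x.1 + x.2, x.1)
  left_inv x := by simp
  right_inv x := by simp

/-- The symbol `σ` defines a bilinear operation of norm at most `B` on the sequences with finite
`wienerNorm t`. -/
def SymbolBound (t B : ℝ) (σ : Freq → Freq → ℂ) : Prop :=
  ∀ p q, japSq (p + q) ^ t * ‖σ p q‖ ≤ B * (japSq p ^ t * japSq q ^ t)

lemma summable_wiener_mul {t B : ℝ} {c d : Freq → ℂ} (hc : InWiener t c) (hd : InWiener t d) :
    Summable fun x : Freq × Freq =>
      B * ((japSq x.1 ^ t * ‖c x.1‖) * (japSq x.2 ^ t * ‖d x.2‖)) :=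
  (Summable.mul_of_nonneg hc hd
    (fun k => mul_nonneg (japSq_rpow_pos k t).le (norm_nonneg _))
    (fun k => mul_nonneg (japSq_rpow_pos k t).le (norm_nonneg _))).mul_left B

section

variable {t B : ℝ} {σ : Freq → Freq → ℂ}

lemma SymbolBound.term_le (hσ : SymbolBound t B σ) (c d : Freq → ℂ) (x : Freq × Freq) :
    japSq x.1 ^ t * ‖σ x.2 (x.1 - x.2) * (c x.2 * d (x.1 - x.2))‖ ≤
      B * ((japSq (splitEquiv x).1 ^ t * ‖c (splitEquiv x).1‖) *
        (japSq (splitEquiv x).2 ^ t * ‖d (splitEquiv x).2‖)) := by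
  have h := hσ x.2 (x.1 - x.2)
  rw [add_sub_cancel] at h
  have h' := mul_le_mul_of_nonneg_right h
    (mul_nonneg (norm_nonneg (c x.2)) (norm_nonneg (d (x.1 - x.2))))
  rw [norm_mul, norm_mul]
  simp only [splitEquiv, Equiv.coe_fn_mk]
  linarith

lemma SymbolBound.summable_pairs (hσ : SymbolBound t B σ) {c d : Freq → ℂ} (hc : InWiener t c)
    (hd : InWiener t d) : Summable fun x : Freq × Freq =>
      japSq x.1 ^ t * ‖σ x.2 (x.1 - x.2) * (c x.2 * d (x.1 - x.2))‖ :=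
  (splitEquiv.summable_iff.2 (summable_wiener_mul (B := B) hc hd)).of_nonneg_of_le
    (fun _ => mul_nonneg (japSq_rpow_pos _ t).le (norm_nonneg _)) (hσ.term_le c d)

lemma SymbolBound.summable_norm_term (hσ : SymbolBound t B σ) {c d : Freq → ℂ}
    (hc : InWiener t c) (hd : InWiener t d) (k : Freq) :
    Summable fun p => ‖σ p (k - p) * (c p * d (k - p))‖ :=
  (summable_mul_left_iff (japSq_rpow_pos k t).ne').1 ((hσ.summable_pairs hc hd).prod_factor k)

lemma SymbolBound.summable_term (hσ : SymbolBound t B σ) {c d : Freq → ℂ}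
    (hc : InWiener t c) (hd : InWiener t d) (k : Freq) :
    Summable fun p => σ p (k - p) * (c p * d (k - p)) :=
  (hσ.summable_norm_term hc hd k).of_norm

lemma SymbolBound.weight_mul_norm_conv_le (hσ : SymbolBound t B σ) {c d : Freq → ℂ}
    (hc : InWiener t c) (hd : InWiener t d) (k : Freq) :
    japSq k ^ t * ‖conv σ c d k‖ ≤
      ∑' p, japSq k ^ t * ‖σ p (k - p) * (c p * d (k - p))‖ := by
  rw [tsum_mul_left]
  exact mul_le_mul_of_nonneg_left (norm_tsum_le_tsum_norm (hσ.summable_norm_term hc hd k))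
    (japSq_rpow_pos k t).le

lemma SymbolBound.inWiener_conv (hσ : SymbolBound t B σ) {c d : Freq → ℂ}
    (hc : InWiener t c) (hd : InWiener t d) : InWiener t (conv σ c d) :=
  (hσ.summable_pairs hc hd).prod.of_nonneg_of_le
    (fun k => mul_nonneg (japSq_rpow_pos k t).le (norm_nonneg _))
    (hσ.weight_mul_norm_conv_le hc hd)

lemma SymbolBound.wienerNorm_conv_le (hσ : SymbolBound t B σ) {c d : Freq → ℂ}
    (hc : InWiener t c) (hd : InWiener t d) :
    wienerNorm t (conv σ c d) ≤ B * (wienerNorm t c * wienerNorm t d) := by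
  have hs := summable_wiener_mul (B := B) hc hd
  calc wienerNorm t (conv σ c d)
      ≤ ∑' k, ∑' p, japSq k ^ t * ‖σ p (k - p) * (c p * d (k - p))‖ :=
        (hσ.inWiener_conv hc hd).tsum_le_tsum (hσ.weight_mul_norm_conv_le hc hd)
          (hσ.summable_pairs hc hd).prod
    _ = ∑' x : Freq × Freq, japSq x.1 ^ t * ‖σ x.2 (x.1 - x.2) * (c x.2 * d (x.1 - x.2))‖ :=
        ((hσ.summable_pairs hc hd).tsum_prod).symm
    _ ≤ ∑' x : Freq × Freq, B * ((japSq (splitEquiv x).1 ^ t * ‖c (splitEquiv x).1‖) *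
        (japSq (splitEquiv x).2 ^ t * ‖d (splitEquiv x).2‖)) :=
        (hσ.summable_pairs hc hd).tsum_le_tsum (hσ.term_le c d)
          (splitEquiv.summable_iff.2 hs)
    _ = ∑' x : Freq × Freq, B * ((japSq x.1 ^ t * ‖c x.1‖) * (japSq x.2 ^ t * ‖d x.2‖)) :=
        splitEquiv.tsum_eq
          (fun x : Freq × Freq => B * ((japSq x.1 ^ t * ‖c x.1‖) * (japSq x.2 ^ t * ‖d x.2‖)))
    _ = B * (wienerNorm t c * wienerNorm t d) := by
        rw [tsum_mul_left, wienerNorm, wienerNorm, hc.tsum_mul_tsum hd]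
        exact Summable.mul_of_nonneg hc hd
          (fun k => mul_nonneg (japSq_rpow_pos k t).le (norm_nonneg _))
          (fun k => mul_nonneg (japSq_rpow_pos k t).le (norm_nonneg _))

lemma SymbolBound.conv_sub_left (hσ : SymbolBound t B σ) {c c' d : Freq → ℂ}
    (hc : InWiener t c) (hc' : InWiener t c') (hd : InWiener t d) (k : Freq) :
    conv σ (fun k => c k - c' k) d k = conv σ c d k - conv σ c' d k := by
  simp only [conv]
  rw [← (hσ.summable_term hc hd k).tsum_sub (hσ.summable_term hc' hd k)]
  exact tsum_congr fun p => by ring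

lemma SymbolBound.conv_sub_right (hσ : SymbolBound t B σ) {c d d' : Freq → ℂ}
    (hc : InWiener t c) (hd : InWiener t d) (hd' : InWiener t d') (k : Freq) :
    conv σ c (fun k => d k - d' k) k = conv σ c d k - conv σ c d' k := by
  simp only [conv]
  rw [← (hσ.summable_term hc hd k).tsum_sub (hσ.summable_term hc hd' k)]
  exact tsum_congr fun p => by ring

lemma IsHermSeq.conv (hσ : ∀ p q, σ (-p) (-q) = conj (σ p q)) {c d : Freq → ℂ}
    (hc : IsHermSeq c) (hd : IsHermSeq d) : IsHermSeq (conv σ c d) := fun k => by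
  simp only [TorusIsometric.conv]
  rw [Complex.conj_tsum, ← (Equiv.neg Freq).tsum_eq]
  refine tsum_congr fun p => ?_
  simp only [Equiv.neg_apply, map_mul]
  rw [show -k - -p = -(k - p) by abel, hσ, hc, hd]

/-- The reflection p ↦ k − p swaps the two equal factors and changes the sign of the symbol. On the
diagonal only the symmetric part of a symbol matters, so Günther's identity need only hold modulo
antisymmetric symbols. -/
lemma conv_self_eq_zero (hσ : ∀ p q, σ p q = -σ q p) (c : Freq → ℂ) (k : Freq) :
    conv σ c c k = 0 := by
  have h : conv σ c c k = -conv σ c c k := by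
    simp only [conv]
    conv_lhs => rw [← (Equiv.subLeft k).tsum_eq]
    rw [← tsum_neg]
    refine tsum_congr fun p => ?_
    simp only [Equiv.subLeft_apply, sub_sub_cancel]
    rw [hσ]; ring
  linear_combination h / 2

end

lemma symbolBound_one {t : ℝ} (ht : 0 ≤ t) : SymbolBound t 1 (fun _ _ => 1) := fun p q => by
  simpa using japSq_add_rpow_le p q ht

lemma synth_mul_synth {c d : Freq → ℂ} (hc : Summable fun k => ‖c k‖)
    (hd : Summable fun k => ‖d k‖) (θ : T2) :
    synth c θ * synth d θ = synth (conv (fun _ _ => 1) c d) θ := by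
  have hc' : Summable fun k => ‖c k * mFourier k θ‖ := by simpa [norm_mFourier_apply] using hc
  have hd' : Summable fun k => ‖d k * mFourier k θ‖ := by simpa [norm_mFourier_apply] using hd
  have hs := summable_mul_of_summable_norm hc' hd'
  simp only [synth]
  have hp := (splitEquiv.summable_iff.2 hs).tsum_prod
  simp only [Function.comp_def] at hp
  rw [tsum_mul_tsum_of_summable_norm hc' hd', ← splitEquiv.tsum_eq, hp]
  refine tsum_congr fun k => ?_
  rw [conv, ← tsum_mul_right]
  refine tsum_congr fun p => ?_
  simp only [splitEquiv, Equiv.coe_fn_mk]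
  have : mFourier k θ = mFourier p θ * mFourier (k - p) θ := by
    rw [← mFourier_add, add_sub_cancel]
  rw [this]; ring

/-! ### Fourier coefficients -/

instance : IsProbabilityMeasure torusMeasure := by unfold torusMeasure; infer_instance

instance : torusMeasure.IsAddHaarMeasure := by unfold torusMeasure; infer_instance

lemma mFourierCoeff_eq (f : T2 → ℂ) (n : Freq) :
    mFourierCoeff f n = ∫ θ, mFourier (-n) θ * f θ ∂torusMeasure := rfl

lemma integral_mFourier_mul (m n : Freq) :
    ∫ θ, mFourier (-m) θ * mFourier n θ ∂torusMeasure = if m = n then 1 else 0 := by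
  have h := orthonormal_iff_ite.1 (orthonormal_mFourier (d := Fin 2)) m n
  rw [ContinuousMap.inner_toLp] at h
  rw [← h]
  refine integral_congr_ae (ae_of_all _ fun θ => ?_)
  simp only [mFourier_neg]
  ring

lemma mFourierCoeff_synth {c : Freq → ℂ} (hc : Summable fun k => ‖c k‖) (n : Freq) :
    mFourierCoeff (synth c) n = c n := by
  have hi (k : Freq) : Integrable (fun θ => mFourier (-n) θ * (c k * mFourier k θ))
      torusMeasure :=
    Continuous.integrable_of_hasCompactSupport (by fun_prop) (HasCompactSupport.of_compactSpace _)
  have h := hasSum_integral_of_summable_integral_norm hi (by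
    simpa [norm_mFourier_apply] using hc)
  have e (k : Freq) : ∫ θ, mFourier (-n) θ * (c k * mFourier k θ) ∂torusMeasure =
      if k = n then c n else 0 := by
    simp only [mul_left_comm _ (c k)]
    rw [integral_const_mul, integral_mFourier_mul]
    by_cases hk : n = k
    · simp [hk]
    · simp [hk, Ne.symm hk]
  simp only [e] at h
  rw [mFourierCoeff_eq]
  simp only [synth, ← tsum_mul_left]
  exact h.unique (hasSum_ite_eq n (c n))

/-- The Fourier series converges to f in L² and, by absolute summability, uniformly to a continuous
function; the two limits agree as classes. Since g is only square-integrable, this is where the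
"almost everywhere" of the theorem arises. -/
lemma ae_eq_synth_mFourierCoeff {f : T2 → ℂ} (hf : MemLp f 2 torusMeasure)
    (hs : Summable fun k => ‖mFourierCoeff f k‖) :
    ∀ᵐ θ ∂torusMeasure, f θ = synth (mFourierCoeff f) θ := by
  have h1 : HasSum (fun k => mFourierCoeff (hf.toLp f) k •
      ContinuousMap.toLp (E := ℂ) 2 torusMeasure ℂ (mFourier k)) (hf.toLp f) :=
    hasSum_mFourier_series_L2 (hf.toLp f)
  have hco (k : Freq) : mFourierCoeff (hf.toLp f) k = mFourierCoeff f k :=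
    integral_congr_ae (by
      filter_upwards [hf.coeFn_toLp] with θ hθ
      rw [hθ])
  simp only [hco] at h1
  let F : C(T2, ℂ) := ⟨synth (mFourierCoeff f), continuous_synth hs⟩
  have hF : HasSum (fun k => mFourierCoeff f k • (mFourier k : C(T2, ℂ))) F := by
    have hsum : Summable (fun k => mFourierCoeff f k • (mFourier k : C(T2, ℂ))) :=
      .of_norm (by simpa [norm_smul, mFourier_norm] using hs)
    convert hsum.hasSum
    ext θ
    exact ContinuousMap.tsum_apply hsum θ
  have h2 := (ContinuousMap.toLp (E := ℂ) 2 torusMeasure ℂ).hasSum hF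
  simp only [map_smul] at h2
  have h3 := h1.unique h2
  filter_upwards [hf.coeFn_toLp, ContinuousMap.coeFn_toLp (p := 2) (𝕜 := ℂ) torusMeasure F]
    with θ h4 h5
  rw [← h4, h3, h5]
  rfl

/-! ### Smooth functions -/

section

variable {E : Type*} [NormedAddCommGroup E] [NormedSpace ℝ E]

/-- The projection of the plane onto the torus. -/
def proj (p : Fin 2 → ℝ) : T2 := fun i => (p i : UnitAddCircle)

lemma isOpenQuotientMap_proj : IsOpenQuotientMap proj :=
  IsOpenQuotientMap.piMap fun _ : Fin 2 => QuotientAddGroup.isOpenQuotientMap_mk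

lemma proj_surjective : Function.Surjective proj := isOpenQuotientMap_proj.surjective

lemma proj_add_single (p : Fin 2 → ℝ) (i : Fin 2) (t : ℝ) :
    proj p + Pi.single i (t : UnitAddCircle) = proj (p + t • Pi.single i 1) := by
  funext j
  by_cases h : j = i
  · subst h; simp [proj]
  · simp [proj, h]

lemma IsC.continuous {n : ℕ∞} {u : T2 → E} (hu : IsC n u) : Continuous u :=
  isOpenQuotientMap_proj.isQuotientMap.continuous_iff.2 (ContDiff.continuous hu)

lemma IsC.hasDerivAt_fderiv {u : T2 → E} (hu : IsC ⊤ u) (i : Fin 2) (p : Fin 2 → ℝ) (t : ℝ) :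
    HasDerivAt (fun s : ℝ => u (proj p + Pi.single i (s : UnitAddCircle)))
      (fderiv ℝ (lift u) (p + t • Pi.single i 1) (Pi.single i 1)) t := by
  simp only [proj_add_single]
  have h1 : HasFDerivAt (lift u) (fderiv ℝ (lift u) (p + t • Pi.single i 1))
      (p + t • Pi.single i 1) :=
    (ContDiff.differentiable hu (by simp)).differentiableAt.hasFDerivAt
  have h2 : HasDerivAt (fun s : ℝ => p + s • (Pi.single i 1 : Fin 2 → ℝ)) (Pi.single i 1) t := by
    simpa using ((hasDerivAt_id t).smul_const (Pi.single i 1 : Fin 2 → ℝ)).const_add p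
  exact h1.comp_hasDerivAt t h2

lemma IsC.lift_pd {u : T2 → E} (hu : IsC ⊤ u) (i : Fin 2) :
    lift (pd i u) = fun p => fderiv ℝ (lift u) p (Pi.single i 1) := by
  funext p
  have := (hu.hasDerivAt_fderiv i p 0).deriv
  simpa using! this

lemma IsC.hasDerivAt {u : T2 → E} (hu : IsC ⊤ u) (i : Fin 2) (θ : T2) (t : ℝ) :
    HasDerivAt (fun s : ℝ => u (θ + Pi.single i (s : UnitAddCircle)))
      (pd i u (θ + Pi.single i (t : UnitAddCircle))) t := by
  obtain ⟨p, rfl⟩ := proj_surjective θ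
  have h := hu.hasDerivAt_fderiv i p t
  have e := congrFun (hu.lift_pd i) (p + t • Pi.single i 1)
  rw [← e] at h
  rw [proj_add_single]
  exact h

lemma IsC.pd {u : T2 → E} (hu : IsC ⊤ u) (i : Fin 2) : IsC ⊤ (pd i u) := by
  unfold IsC
  rw [hu.lift_pd i]
  have : ContDiff ℝ (⊤ : ℕ∞) (fderiv ℝ (lift u)) :=
    ContDiff.fderiv_right hu (by simp)
  exact this.clm_apply contDiff_const

end

lemma mFourierCoeff_translate {u : T2 → ℂ} (k : Freq) (φ : T2) :
    ∫ θ, mFourier (-k) θ * u (θ + φ) ∂torusMeasure = mFourier k φ * mFourierCoeff u k := by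
  have h := integral_add_right_eq_self (μ := torusMeasure)
    (fun θ => mFourier (-k) (θ - φ) * u θ) φ
  simp only [add_sub_cancel_right] at h
  rw [h, mFourierCoeff_eq, ← integral_const_mul]
  refine integral_congr_ae (ae_of_all _ fun θ => ?_)
  have e1 : mFourier (-k) θ = mFourier (-k) (θ - φ) * mFourier (-k) φ := by
    rw [← mFourier_add_apply, sub_add_cancel]
  have e2 : mFourier k φ * mFourier (-k) φ = 1 := by
    rw [← mFourier_add, add_neg_cancel, mFourier_zero]; rfl
  simp only [e1]
  linear_combination (-(mFourier (-k) (θ - φ) * u θ)) * e2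

lemma integrable_of_continuous {f : T2 → ℂ} (hf : Continuous f) : Integrable f torusMeasure :=
  hf.integrable_of_hasCompactSupport (HasCompactSupport.of_compactSpace _)

/-- In place of integration by parts, the k-th coefficient of the translate of u by t in direction i
is computed in two ways: translation multiplies it by exp(t · `dsym i k`), and the integral may be
differentiated in t under the sign. -/
lemma IsC.mFourierCoeff_pd {u : T2 → ℂ} (hu : IsC ⊤ u) (i : Fin 2) (k : Freq) :
    mFourierCoeff (TorusIsometric.pd i u) k = dsym i k * mFourierCoeff u k := by
  have hc := hu.continuous
  have hc' := (hu.pd i).continuous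
  obtain ⟨B, hB⟩ := (isCompact_univ.image hc'.norm).bddAbove
  have hB' (θ : T2) : ‖TorusIsometric.pd i u θ‖ ≤ B := hB ⟨θ, trivial, rfl⟩
  let F (t : ℝ) (θ : T2) : ℂ := mFourier (-k) θ * u (θ + Pi.single i (t : UnitAddCircle))
  let F' (t : ℝ) (θ : T2) : ℂ :=
    mFourier (-k) θ * TorusIsometric.pd i u (θ + Pi.single i (t : UnitAddCircle))
  have hF (t : ℝ) : Continuous (F t) :=
    (mFourier (-k)).continuous.mul (hc.comp (continuous_id.add continuous_const))
  have hF' (t : ℝ) : Continuous (F' t) :=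
    (mFourier (-k)).continuous.mul (hc'.comp (continuous_id.add continuous_const))
  have hbound : ∀ᵐ θ ∂torusMeasure, ∀ t ∈ Set.univ, ‖F' t θ‖ ≤ B := ae_of_all _ fun θ t _ => by
    simp only [F', norm_mul, norm_mFourier_apply, one_mul]
    exact hB' _
  have hdiff : ∀ᵐ θ ∂torusMeasure, ∀ t ∈ Set.univ, HasDerivAt (F · θ) (F' t θ) t :=
    ae_of_all _ fun θ t _ => (hu.hasDerivAt i θ t).const_mul (mFourier (-k) θ)
  have h := (hasDerivAt_integral_of_dominated_loc_of_deriv_le (μ := torusMeasure) (𝕜 := ℝ)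
    (x₀ := 0) Filter.univ_mem
    (Filter.Eventually.of_forall fun t => (hF t).aestronglyMeasurable)
    (integrable_of_continuous (hF 0)) (hF' 0).aestronglyMeasurable hbound
    (integrable_const B) hdiff).2
  simp only [F, F', mFourierCoeff_translate, mFourier_single_apply] at h
  have h2 : HasDerivAt (fun t : ℝ => exp (dsym i k * t) * mFourierCoeff u k)
      (exp (dsym i k * (0 : ℝ)) * (dsym i k * 1) * mFourierCoeff u k) 0 := by
    have := ((ofRealCLM.hasDerivAt (x := 0)).const_mul (dsym i k)).cexp
    exact this.mul_const _
  simpa using h.unique h2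

lemma IsC.sub {E : Type*} [NormedAddCommGroup E] [NormedSpace ℝ E] {n : ℕ∞} {u v : T2 → E}
    (hu : IsC n u) (hv : IsC n v) : IsC n (fun θ => u θ - v θ) :=
  ContDiff.sub hu hv

lemma mFourierCoeff_sub {u v : T2 → ℂ} (hu : Integrable u torusMeasure)
    (hv : Integrable v torusMeasure) (k : Freq) :
    mFourierCoeff (fun θ => u θ - v θ) k = mFourierCoeff u k - mFourierCoeff v k := by
  have hm {w : T2 → ℂ} (hw : Integrable w torusMeasure) :
      Integrable (fun θ => mFourier (-k) θ * w θ) torusMeasure :=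
    hw.bdd_mul (c := 1) (by fun_prop : Continuous (mFourier (-k))).aestronglyMeasurable
      (ae_of_all _ fun θ => (norm_mFourier_apply _ _).le)
  simp only [mFourierCoeff_eq, mul_sub]
  exact integral_sub (hm hu) (hm hv)

lemma norm_mFourierCoeff_le {u : T2 → ℂ} {B : ℝ} (hB : ∀ θ, ‖u θ‖ ≤ B) (k : Freq) :
    ‖mFourierCoeff u k‖ ≤ B := by
  have := norm_integral_le_of_norm_le_const (μ := torusMeasure)
    (f := fun θ => mFourier (-k) θ * u θ) (C := B)
    (ae_of_all _ fun θ => by rw [norm_mul, norm_mFourier_apply, one_mul]; exact hB θ)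
  simpa [mFourierCoeff_eq] using this

/-- Each application of 1 − Δ multiplies the k-th coefficient by `japSq k`, and the coefficients of
a continuous function on the torus are bounded. -/
lemma IsC.exists_decay (n : ℕ) : ∀ {u : T2 → ℂ}, IsC ⊤ u →
    ∃ B, ∀ k, japSq k ^ n * ‖mFourierCoeff u k‖ ≤ B := by
  induction n with
  | zero =>
    intro u hu
    obtain ⟨B, hB⟩ := (isCompact_univ.image hu.continuous.norm).bddAbove
    exact ⟨B, fun k => by simpa using norm_mFourierCoeff_le (fun θ => hB ⟨θ, trivial, rfl⟩) k⟩
  | succ n ih =>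
    intro u hu
    have h0 := (hu.pd 0).pd 0
    have h1 := (hu.pd 1).pd 1
    obtain ⟨B, hB⟩ := ih ((hu.sub h0).sub h1)
    refine ⟨B, fun k => (le_of_eq ?_).trans (hB k)⟩
    rw [mFourierCoeff_sub (integrable_of_continuous (hu.sub h0).continuous)
      (integrable_of_continuous h1.continuous),
      mFourierCoeff_sub (integrable_of_continuous hu.continuous)
      (integrable_of_continuous h0.continuous), (hu.pd 0).mFourierCoeff_pd, hu.mFourierCoeff_pd,
      (hu.pd 1).mFourierCoeff_pd, hu.mFourierCoeff_pd]
    have : mFourierCoeff u k - dsym 0 k * (dsym 0 k * mFourierCoeff u k)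
        - dsym 1 k * (dsym 1 k * mFourierCoeff u k) = japSq k * mFourierCoeff u k := by
      rw [japSq_eq]; ring
    rw [this, norm_mul, norm_real, Real.norm_of_nonneg (japSq_pos k).le]
    ring

lemma IsC.inWiener {u : T2 → ℂ} (hu : IsC ⊤ u) (t : ℝ) : InWiener t (mFourierCoeff u) := by
  -- Two powers beyond `t` are kept in reserve, to leave the summable sequence `japSq k ^ (-2)`.
  obtain ⟨n, hn⟩ := exists_nat_gt (t + 2)
  obtain ⟨B, hB⟩ := hu.exists_decay n
  refine ((summable_japSq_rpow_neg one_lt_two).mul_left B).of_nonneg_of_le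
    (fun k => mul_nonneg (japSq_rpow_pos k t).le (norm_nonneg _)) fun k => ?_
  have h1 : japSq k ^ t ≤ japSq k ^ n * japSq k ^ (-2 : ℝ) := by
    rw [← Real.rpow_natCast, ← Real.rpow_add (japSq_pos k)]
    exact Real.rpow_le_rpow_of_exponent_le (one_le_japSq k) (by linarith)
  calc japSq k ^ t * ‖mFourierCoeff u k‖
      ≤ japSq k ^ n * japSq k ^ (-2 : ℝ) * ‖mFourierCoeff u k‖ := by gcongr
    _ = japSq k ^ n * ‖mFourierCoeff u k‖ * japSq k ^ (-2 : ℝ) := by ring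
    _ ≤ B * japSq k ^ (-2 : ℝ) :=
      mul_le_mul_of_nonneg_right (hB k) (japSq_rpow_pos k _).le

lemma IsC.eq_synth {u : T2 → ℂ} (hu : IsC ⊤ u) (θ : T2) : u θ = synth (mFourierCoeff u) θ := by
  have h := hasSum_mFourier_series_apply_of_summable (f := ⟨u, hu.continuous⟩)
    (((hu.inWiener 0).summable_norm le_rfl).of_norm) θ
  exact h.tsum_eq.symm

lemma isHermSeq_mFourierCoeff (u : T2 → ℝ) :
    IsHermSeq (mFourierCoeff fun θ => (u θ : ℂ)) := fun k => by
  rw [mFourierCoeff_eq, mFourierCoeff_eq, ← integral_conj]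
  refine integral_congr_ae (ae_of_all _ fun θ => ?_)
  simp [mFourier_neg]

/-! ### A quadratic fixed point equation -/

/-- On the ball of radius 2‖H‖ the map v ↦ H + Q v v has Lipschitz constant 4K‖H‖, which the
smallness condition makes at most 1/2. The closed set `S` carries the reality constraint; it need
only be invariant, and Q need only be additive in each argument. -/
theorem exists_quadratic_fixedPoint {E : Type*} [NormedAddCommGroup E] [CompleteSpace E]
    {Q : E → E → E} {K : ℝ} (hK : 0 ≤ K) (hQ : ∀ v w, ‖Q v w‖ ≤ K * (‖v‖ * ‖w‖))
    (hl : ∀ v v' w, Q (v - v') w = Q v w - Q v' w) (hr : ∀ v w w', Q v (w - w') = Q v w - Q v w')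
    {S : Set E} (hS : IsClosed S) (h0 : 0 ∈ S) {H : E} (hHS : ∀ v ∈ S, H + Q v v ∈ S)
    (hH : 8 * K * ‖H‖ ≤ 1) : ∃ v ∈ S, v = H + Q v v ∧ ‖v‖ ≤ 2 * ‖H‖ := by
  let T : Set E := S ∩ Metric.closedBall 0 (2 * ‖H‖)
  have hT : IsComplete T := (hS.inter Metric.isClosed_closedBall).isComplete
  have hmaps : Set.MapsTo (fun v => H + Q v v) T T := by
    rintro v ⟨hv, hv'⟩
    refine ⟨hHS v hv, ?_⟩
    rw [mem_closedBall_zero_iff] at hv' ⊢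
    have h1 : ‖v‖ * ‖v‖ ≤ (2 * ‖H‖) * (2 * ‖H‖) :=
      mul_le_mul hv' hv' (norm_nonneg _) (by positivity)
    have h2 := mul_le_mul_of_nonneg_left h1 hK
    have h3 := mul_le_mul_of_nonneg_right hH (norm_nonneg H)
    linarith [norm_add_le H (Q v v), hQ v v, norm_nonneg H]
  have hcontr : ContractingWith (1 / 2) (hmaps.restrict (fun v => H + Q v v) T T) := by
    refine ⟨by rw [← NNReal.coe_lt_coe]; norm_num, LipschitzWith.of_dist_le_mul ?_⟩
    rintro ⟨v, _, hv⟩ ⟨w, _, hw⟩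
    rw [mem_closedBall_zero_iff] at hv hw
    simp only [Subtype.dist_eq, Set.MapsTo.val_restrict_apply, dist_eq_norm]
    -- Biadditivity splits the difference so that each term contains v − w once.
    have e : H + Q v v - (H + Q w w) = Q (v - w) v + Q w (v - w) := by
      rw [hl, hr]; abel
    rw [e]
    have h1 := hQ (v - w) v
    have h2 := hQ w (v - w)
    have h3 : K * (‖v - w‖ * ‖v‖) ≤ K * (‖v - w‖ * (2 * ‖H‖)) := by gcongr
    have h4 : K * (‖w‖ * ‖v - w‖) ≤ K * ((2 * ‖H‖) * ‖v - w‖) := by gcongr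
    have h5 := mul_le_mul_of_nonneg_right hH (norm_nonneg (v - w))
    have h6 := norm_add_le (Q (v - w) v) (Q w (v - w))
    push_cast
    linarith
  obtain ⟨v, hv, hfix, -⟩ := hcontr.exists_fixedPoint' hT hmaps
    (x := 0) ⟨h0, by simp⟩ (edist_ne_top _ _)
  exact ⟨v, hv.1, hfix.symm, mem_closedBall_zero_iff.1 hv.2⟩

/-! ### Weighted sequences as elements of the Banach space ℓ¹. -/

/-- Absolutely summable sequences. -/
abbrev EllOne : Type := lp (fun _ : Freq => ℂ) 1

lemma EllOne.summable_norm (a : EllOne) : Summable fun k => ‖a k‖ := by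
  simpa using a.2.summable (by simp)

lemma EllOne.norm_eq (a : EllOne) : ‖a‖ = ∑' k, ‖a k‖ := by
  simpa using lp.norm_eq_tsum_rpow (p := 1) (by simp) a

/-- The sequence with finite `wienerNorm t` that corresponds to a summable one. -/
def unweight (t : ℝ) (a : EllOne) (k : Freq) : ℂ := (japSq k ^ (-t) : ℝ) * a k

/-- The summable sequence that corresponds to one with finite `wienerNorm t`. -/
def weight {t : ℝ} {c : Freq → ℂ} (hc : InWiener t c) : EllOne :=
  ⟨fun k => (japSq k ^ t : ℝ) * c k, memℓp_gen (by
    simpa [abs_of_pos (japSq_rpow_pos _ t), InWiener] using hc)⟩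

lemma weight_mul_norm_unweight (t : ℝ) (a : EllOne) (k : Freq) :
    japSq k ^ t * ‖unweight t a k‖ = ‖a k‖ := by
  rw [unweight, norm_mul, norm_real, Real.norm_of_nonneg (japSq_rpow_pos k _).le, ← mul_assoc,
    ← Real.rpow_add (japSq_pos k), add_neg_cancel, Real.rpow_zero, one_mul]

lemma inWiener_unweight (t : ℝ) (a : EllOne) : InWiener t (unweight t a) := by
  simpa only [InWiener, weight_mul_norm_unweight] using a.summable_norm

lemma wienerNorm_unweight (t : ℝ) (a : EllOne) : wienerNorm t (unweight t a) = ‖a‖ := by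
  simp only [wienerNorm, weight_mul_norm_unweight, a.norm_eq]

lemma weight_apply {t : ℝ} {c : Freq → ℂ} (hc : InWiener t c) (k : Freq) :
    weight hc k = (japSq k ^ t : ℝ) * c k := rfl

lemma norm_weight {t : ℝ} {c : Freq → ℂ} (hc : InWiener t c) : ‖weight hc‖ = wienerNorm t c := by
  rw [EllOne.norm_eq, wienerNorm]
  refine tsum_congr fun k => ?_
  rw [weight_apply, norm_mul, norm_real, Real.norm_of_nonneg (japSq_rpow_pos k _).le]

lemma unweight_add (t : ℝ) (a b : EllOne) (k : Freq) :
    unweight t (a + b) k = unweight t a k + unweight t b k := by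
  simp [unweight, mul_add]

lemma unweight_sub (t : ℝ) (a b : EllOne) :
    unweight t (a - b) = fun k => unweight t a k - unweight t b k := by
  funext k
  simp [unweight, mul_sub]

lemma unweight_weight {t : ℝ} {c : Freq → ℂ} (hc : InWiener t c) : unweight t (weight hc) = c := by
  funext k
  rw [unweight, weight_apply, ← mul_assoc, ← ofReal_mul, ← Real.rpow_add (japSq_pos k),
    neg_add_cancel, Real.rpow_zero, ofReal_one, one_mul]

lemma unweight_injective (t : ℝ) : Function.Injective (unweight t) := fun a b h => by
  ext k
  have : ((japSq k ^ (-t) : ℝ) : ℂ) ≠ 0 := ofReal_ne_zero.2 (japSq_rpow_pos k _).ne'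
  exact mul_left_cancel₀ this (congrFun h k)

lemma isHermSeq_unweight_iff {t : ℝ} {a : EllOne} :
    IsHermSeq (unweight t a) ↔ ∀ k, a (-k) = conj (a k) := by
  refine forall_congr' fun k => ?_
  have : ((japSq k ^ (-t) : ℝ) : ℂ) ≠ 0 := ofReal_ne_zero.2 (japSq_rpow_pos k _).ne'
  simp only [unweight, japSq_neg, map_mul, conj_ofReal]
  exact mul_right_inj' this

/-- The constraint is a family of equations between coordinates, and coordinates are continuous on
ℓ¹. It lets the fixed point inherit reality. -/
lemma isClosed_isHermSeq (t : ℝ) : IsClosed {a : EllOne | IsHermSeq (unweight t a)} := by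
  have heval (k : Freq) : Continuous fun a : EllOne => a k :=
    (lp.lipschitzWith_one_eval 1 k).continuous
  simp only [isHermSeq_unweight_iff, Set.ofPred_forall]
  exact isClosed_iInter fun k => isClosed_eq (heval (-k)) (continuous_conj.comp (heval k))

lemma wienerNorm_sum_le {ι : Type*} (s : Finset ι) {t : ℝ} {c : ι → Freq → ℂ}
    (hc : ∀ a, InWiener t (c a)) :
    wienerNorm t (fun k => ∑ a ∈ s, c a k) ≤ ∑ a ∈ s, wienerNorm t (c a) := by
  have hs : Summable fun k => ∑ a ∈ s, japSq k ^ t * ‖c a k‖ := summable_sum fun a _ => hc a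
  calc wienerNorm t (fun k => ∑ a ∈ s, c a k) ≤ ∑' k, ∑ a ∈ s, japSq k ^ t * ‖c a k‖ := by
        refine Summable.tsum_le_tsum (fun k => ?_) (InWiener.sum s hc) hs
        rw [← Finset.mul_sum]
        exact mul_le_mul_of_nonneg_left (norm_sum_le _ _) (japSq_rpow_pos k t).le
    _ = ∑ a ∈ s, wienerNorm t (c a) := Summable.tsum_finsetSum fun a _ => hc a

lemma SymbolBound.conv_add_right {t B : ℝ} {σ : Freq → Freq → ℂ} (hσ : SymbolBound t B σ)
    {c d d' : Freq → ℂ} (hc : InWiener t c) (hd : InWiener t d) (hd' : InWiener t d') (k : Freq) :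
    conv σ c (fun k => d k + d' k) k = conv σ c d k + conv σ c d' k := by
  simp only [conv]
  rw [← (hσ.summable_term hc hd k).tsum_add (hσ.summable_term hc hd' k)]
  exact tsum_congr fun p => by ring

/-! ### Systems of convolution equations. -/

section

variable {t : ℝ} {ι : Type*} [Fintype ι]

/-- The multiplication of a vector function by a matrix function, on Fourier coefficients. -/
def convMatVec (m : ι → ι → Freq → ℂ) (c : ι → Freq → ℂ) (a : ι) (k : Freq) : ℂ :=
  ∑ r, conv (fun _ _ => 1) (m a r) (c r) k

/-- The bilinear operations with symbols `σ r`, summed over the components. -/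
def convDot (σ : ι → Freq → Freq → ℂ) (v w : ι → Freq → ℂ) (r : ι) (k : Freq) : ℂ :=
  ∑ a, conv (σ r) (v a) (w a) k

lemma inWiener_convMatVec (ht : 0 ≤ t) {m : ι → ι → Freq → ℂ} (hm : ∀ a r, InWiener t (m a r))
    {c : ι → Freq → ℂ} (hc : ∀ r, InWiener t (c r)) (a : ι) : InWiener t (convMatVec m c a) :=
  InWiener.sum _ fun r => (symbolBound_one ht).inWiener_conv (hm a r) (hc r)

lemma inWiener_convDot {B : ℝ} {σ : ι → Freq → Freq → ℂ} (hσ : ∀ r, SymbolBound t B (σ r))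
    {v w : ι → Freq → ℂ} (hv : ∀ a, InWiener t (v a)) (hw : ∀ a, InWiener t (w a)) (r : ι) :
    InWiener t (convDot σ v w r) :=
  InWiener.sum _ fun a => (hσ r).inWiener_conv (hv a) (hw a)

lemma isHermSeq_convMatVec {m : ι → ι → Freq → ℂ} (hm : ∀ a r, IsHermSeq (m a r))
    {c : ι → Freq → ℂ} (hc : ∀ r, IsHermSeq (c r)) (a : ι) : IsHermSeq (convMatVec m c a) :=
  IsHermSeq.sum _ fun r => IsHermSeq.conv (by simp) (hm a r) (hc r)

lemma isHermSeq_convDot {σ : ι → Freq → Freq → ℂ} (hσ : ∀ r p q, σ r (-p) (-q) = conj (σ r p q))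
    {v w : ι → Freq → ℂ} (hv : ∀ a, IsHermSeq (v a)) (hw : ∀ a, IsHermSeq (w a)) (r : ι) :
    IsHermSeq (convDot σ v w r) :=
  IsHermSeq.sum _ fun a => IsHermSeq.conv (hσ r) (hv a) (hw a)

lemma wienerNorm_convMatVec_le (ht : 0 ≤ t) {m : ι → ι → Freq → ℂ}
    (hm : ∀ a r, InWiener t (m a r)) {c : ι → Freq → ℂ} (hc : ∀ r, InWiener t (c r)) {D : ℝ}
    (hD : ∀ r, wienerNorm t (c r) ≤ D) (a : ι) :
    wienerNorm t (convMatVec m c a) ≤ (∑ a, ∑ r, wienerNorm t (m a r)) * D := by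
  have hD0 : 0 ≤ D := (wienerNorm_nonneg t _).trans (hD a)
  calc wienerNorm t (convMatVec m c a)
      ≤ ∑ r, wienerNorm t (conv (fun _ _ => 1) (m a r) (c r)) :=
        wienerNorm_sum_le _ fun r => (symbolBound_one ht).inWiener_conv (hm a r) (hc r)
    _ ≤ ∑ r, wienerNorm t (m a r) * D := by
        refine Finset.sum_le_sum fun r _ => ?_
        refine ((symbolBound_one ht).wienerNorm_conv_le (hm a r) (hc r)).trans ?_
        rw [one_mul]
        exact mul_le_mul_of_nonneg_left (hD r) (wienerNorm_nonneg t _)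
    _ = (∑ r, wienerNorm t (m a r)) * D := by rw [Finset.sum_mul]
    _ ≤ (∑ a, ∑ r, wienerNorm t (m a r)) * D :=
        mul_le_mul_of_nonneg_right (Finset.single_le_sum
          (f := fun a => ∑ r, wienerNorm t (m a r))
          (fun a _ => Finset.sum_nonneg fun r _ => wienerNorm_nonneg t _) (Finset.mem_univ a)) hD0

lemma wienerNorm_convDot_le {B : ℝ} (hB : 0 ≤ B) {σ : ι → Freq → Freq → ℂ}
    (hσ : ∀ r, SymbolBound t B (σ r)) {v w : ι → Freq → ℂ} (hv : ∀ a, InWiener t (v a))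
    (hw : ∀ a, InWiener t (w a)) {V W : ℝ} (hV : ∀ a, wienerNorm t (v a) ≤ V)
    (hW : ∀ a, wienerNorm t (w a) ≤ W) (r : ι) :
    wienerNorm t (convDot σ v w r) ≤ Fintype.card ι * B * (V * W) := by
  calc wienerNorm t (convDot σ v w r) ≤ ∑ a, wienerNorm t (conv (σ r) (v a) (w a)) :=
        wienerNorm_sum_le _ fun a => (hσ r).inWiener_conv (hv a) (hw a)
    _ ≤ ∑ _a : ι, B * (V * W) := by
        refine Finset.sum_le_sum fun a _ => ?_
        refine ((hσ r).wienerNorm_conv_le (hv a) (hw a)).trans ?_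
        refine mul_le_mul_of_nonneg_left ?_ hB
        exact mul_le_mul (hV a) (hW a) (wienerNorm_nonneg t _)
          ((wienerNorm_nonneg t _).trans (hV a))
    _ = Fintype.card ι * B * (V * W) := by simp [mul_assoc]

/-- Weighting identifies the unknowns with a finite product of copies of ℓ¹ under the maximum norm,
where `exists_quadratic_fixedPoint` applies with H = m∗η and Q(v,w) = m∗σ(v,w). -/
theorem exists_wiener_fixedPoint (ht : 0 ≤ t) {m : ι → ι → Freq → ℂ}
    (hm : ∀ a r, InWiener t (m a r)) (hmh : ∀ a r, IsHermSeq (m a r))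
    {B : ℝ} (hB : 0 ≤ B) {σ : ι → Freq → Freq → ℂ} (hσ : ∀ r, SymbolBound t B (σ r))
    (hσh : ∀ r p q, σ r (-p) (-q) = conj (σ r p q)) :
    ∃ ε > 0, ∃ C > 0, ∀ (η : ι → Freq → ℂ) (D : ℝ), (∀ r, InWiener t (η r)) →
      (∀ r, IsHermSeq (η r)) → (∀ r, wienerNorm t (η r) ≤ D) → 0 ≤ D → D ≤ ε →
      ∃ v : ι → Freq → ℂ, (∀ a, InWiener t (v a)) ∧ (∀ a, IsHermSeq (v a)) ∧
        (∀ a, wienerNorm t (v a) ≤ C * D) ∧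
        v = convMatVec m (fun r k => η r k + convDot σ v v r k) := by
  set M : ℝ := ∑ a, ∑ r, wienerNorm t (m a r)
  have hM : 0 ≤ M :=
    Finset.sum_nonneg fun a _ => Finset.sum_nonneg fun r _ => wienerNorm_nonneg t _
  set K : ℝ := M * (Fintype.card ι * B)
  have hK : 0 ≤ K := by positivity
  -- Since ‖H‖ ≤ M·D, the condition D ≤ ε gives 8K‖H‖ ≤ 1, and the bound 2‖H‖ becomes 2M·D. The
  -- added ones keep both constants positive if M = 0.
  refine ⟨1 / (8 * K * M + 1), by positivity, 2 * M + 1, by positivity, ?_⟩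
  intro η D hη hηh hD hD0 hDε
  have huw := fun (v : ι → EllOne) (a : ι) => inWiener_unweight t (v a)
  have hdot := fun (v w : ι → EllOne) => inWiener_convDot hσ (huw v) (huw w)
  let H : ι → EllOne := fun a => weight (inWiener_convMatVec ht hm hη a)
  let Q : (ι → EllOne) → (ι → EllOne) → ι → EllOne := fun v w a =>
    weight (inWiener_convMatVec ht hm (hdot v w) a)
  have hHn : ‖H‖ ≤ M * D := by
    refine (pi_norm_le_iff_of_nonneg (by positivity)).2 fun a => ?_
    rw [norm_weight]
    exact wienerNorm_convMatVec_le ht hm hη hD a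
  have hQ : ∀ v w, ‖Q v w‖ ≤ K * (‖v‖ * ‖w‖) := fun v w => by
    refine (pi_norm_le_iff_of_nonneg (by positivity)).2 fun a => ?_
    rw [norm_weight]
    refine (wienerNorm_convMatVec_le ht hm (hdot v w)
      (wienerNorm_convDot_le hB hσ (huw v) (huw w) (V := ‖v‖) (W := ‖w‖)
        (fun a => ?_) fun a => ?_) a).trans_eq ?_
    · rw [wienerNorm_unweight]; exact norm_le_pi_norm v a
    · rw [wienerNorm_unweight]; exact norm_le_pi_norm w a
    · simp only [K]; ring
  have hl : ∀ v v' w, Q (v - v') w = Q v w - Q v' w := fun v v' w => by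
    have e : convDot σ (fun a => unweight t ((v - v') a)) (fun a => unweight t (w a)) =
        fun r k => convDot σ (fun a => unweight t (v a)) (fun a => unweight t (w a)) r k -
          convDot σ (fun a => unweight t (v' a)) (fun a => unweight t (w a)) r k := by
      funext r k
      simp only [convDot, Pi.sub_apply, unweight_sub]
      rw [← Finset.sum_sub_distrib]
      exact Finset.sum_congr rfl fun a _ =>
        (hσ r).conv_sub_left (huw v a) (huw v' a) (huw w a) k
    funext a
    refine unweight_injective t (funext fun k => ?_)
    rw [Pi.sub_apply, unweight_sub]
    simp only [Q, unweight_weight]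
    rw [convMatVec, convMatVec, convMatVec, ← Finset.sum_sub_distrib, e]
    exact Finset.sum_congr rfl fun r _ =>
      (symbolBound_one ht).conv_sub_right (hm a r) (hdot v w r) (hdot v' w r) k
  have hr : ∀ v w w', Q v (w - w') = Q v w - Q v w' := fun v w w' => by
    have e : convDot σ (fun a => unweight t (v a)) (fun a => unweight t ((w - w') a)) =
        fun r k => convDot σ (fun a => unweight t (v a)) (fun a => unweight t (w a)) r k -
          convDot σ (fun a => unweight t (v a)) (fun a => unweight t (w' a)) r k := by
      funext r k
      simp only [convDot, Pi.sub_apply, unweight_sub]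
      rw [← Finset.sum_sub_distrib]
      exact Finset.sum_congr rfl fun a _ =>
        (hσ r).conv_sub_right (huw v a) (huw w a) (huw w' a) k
    funext a
    refine unweight_injective t (funext fun k => ?_)
    rw [Pi.sub_apply, unweight_sub]
    simp only [Q, unweight_weight]
    rw [convMatVec, convMatVec, convMatVec, ← Finset.sum_sub_distrib, e]
    exact Finset.sum_congr rfl fun r _ =>
      (symbolBound_one ht).conv_sub_right (hm a r) (hdot v w r) (hdot v w' r) k
  let S : Set (ι → EllOne) := {v | ∀ a, IsHermSeq (unweight t (v a))}
  have hS : IsClosed S := by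
    have : S = ⋂ a, (fun v : ι → EllOne => v a) ⁻¹' {b | IsHermSeq (unweight t b)} := by
      ext v; simp [S]
    rw [this]
    exact isClosed_iInter fun a => (isClosed_isHermSeq t).preimage (continuous_apply a)
  have h0 : (0 : ι → EllOne) ∈ S := fun a => isHermSeq_unweight_iff.2 fun k => by simp
  have hfix (v : ι → EllOne) (a : ι) (k : Freq) : unweight t ((H + Q v v) a) k =
      convMatVec m (fun r k => η r k + convDot σ (fun a => unweight t (v a))
        (fun a => unweight t (v a)) r k) a k := by
    simp only [Pi.add_apply, unweight_add, H, Q, unweight_weight, convMatVec]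
    rw [← Finset.sum_add_distrib]
    exact Finset.sum_congr rfl fun r _ =>
      ((symbolBound_one ht).conv_add_right (hm a r) (hη r) (hdot v v r) k).symm
  have hHS : ∀ v ∈ S, H + Q v v ∈ S := fun v hv a => by
    have : unweight t ((H + Q v v) a) = _ := funext (hfix v a)
    rw [this]
    exact isHermSeq_convMatVec hmh (fun r => (hηh r).add (isHermSeq_convDot hσh hv hv r)) a
  have hsmall : 8 * K * ‖H‖ ≤ 1 := by
    rw [le_div_iff₀ (by positivity)] at hDε
    have := mul_le_mul_of_nonneg_left hHn (show 0 ≤ 8 * K by positivity)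
    nlinarith
  obtain ⟨v, hvS, hv, hvn⟩ := exists_quadratic_fixedPoint hK hQ hl hr hS h0 hHS hsmall
  refine ⟨fun a => unweight t (v a), huw v, hvS, fun a => ?_, ?_⟩
  · rw [wienerNorm_unweight]
    have := norm_le_pi_norm v a
    linarith
  · funext a k
    rw [← hfix v a k, ← hv]

end

/-! ### Günther's form of the isometric embedding equation -/

/-- The symbol of `Δv · ∂_j v`. -/
def lapNum (j : Fin 2) (p q : Freq) : ℂ := (dsym 0 p ^ 2 + dsym 1 p ^ 2) * dsym j q

/-- The symbol of `2 ∑_l ∂_i∂_l v · ∂_j∂_l v - 2 Δv · ∂_i∂_j v - ∂_i v · ∂_j v`. -/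
def hessNum (i j : Fin 2) (p q : Freq) : ℂ :=
  2 * (dsym i p * dsym 0 p * (dsym j q * dsym 0 q) + dsym i p * dsym 1 p * (dsym j q * dsym 1 q))
    - 2 * ((dsym 0 p ^ 2 + dsym 1 p ^ 2) * (dsym i q * dsym j q)) - dsym i p * dsym j q

/-- The symbols of the quadratic terms of the five equations. -/
def guntherNum (r : Fin 5) (p q : Freq) : ℂ :=
  (![lapNum 0 p q, lapNum 1 p q, -(1 / 2) * hessNum 0 0 p q, -(1 / 2) * hessNum 0 1 p q,
    -(1 / 2) * hessNum 1 1 p q] : Fin 5 → ℂ) r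

/-- The symbols of the quadratic terms of the five equations, after `(1 - Δ)⁻¹`. -/
def guntherSym (r : Fin 5) (p q : Freq) : ℂ := guntherNum r p q / japSq (p + q)

/-- The row of a first derivative in `oscMatrix`. -/
def row₁ (i : Fin 2) : Fin 5 := ![0, 1] i

/-- The row of a second derivative in `oscMatrix`. -/
def row₂ (i j : Fin 2) : Fin 5 := ![![2, 3], ![3, 4]] i j

/-- The symbols of the rows of `oscMatrix`. -/
def oscSym (r : Fin 5) (k : Freq) : ℂ :=
  (![dsym 0 k, dsym 1 k, dsym 0 k * dsym 0 k, dsym 0 k * dsym 1 k, dsym 1 k * dsym 1 k] :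
    Fin 5 → ℂ) r

lemma oscSym_row₁ (i : Fin 2) (k : Freq) : oscSym (row₁ i) k = dsym i k := by
  fin_cases i <;> rfl

lemma oscSym_row₂ (i j : Fin 2) (k : Freq) : oscSym (row₂ i j) k = dsym i k * dsym j k := by
  fin_cases i <;> fin_cases j <;> first | rfl | exact mul_comm _ _

lemma guntherNum_row₁ (i : Fin 2) (p q : Freq) : guntherNum (row₁ i) p q = lapNum i p q := by
  fin_cases i <;> rfl

lemma guntherNum_row₂ {i j : Fin 2} (hij : i ≤ j) (p q : Freq) :
    guntherNum (row₂ i j) p q = -(1 / 2) * hessNum i j p q := by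
  fin_cases i <;> fin_cases j <;> first | rfl | exact absurd hij (by decide)

lemma guntherSym_neg (r : Fin 5) (p q : Freq) :
    guntherSym r (-p) (-q) = conj (guntherSym r p q) := by
  have h : guntherNum r (-p) (-q) = conj (guntherNum r p q) := by
    fin_cases r <;> simp [guntherNum, lapNum, hessNum, dsym_neg, Complex.conj_ofNat]
  rw [guntherSym, guntherSym, h, map_div₀, conj_ofReal, ← neg_add, japSq_neg]

lemma norm_lap_le (p : Freq) : ‖dsym 0 p ^ 2 + dsym 1 p ^ 2‖ ≤ 2 * japSq p := by
  refine (norm_add_le _ _).trans ?_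
  rw [norm_pow, norm_pow]
  linarith [norm_dsym_sq_le 0 p, norm_dsym_sq_le 1 p]

lemma norm_lapNum_le (j : Fin 2) (p q : Freq) : ‖lapNum j p q‖ ≤ 9 * (japSq p * japSq q) := by
  have h := mul_le_mul (norm_lap_le p) (norm_dsym_le j q) (norm_nonneg _)
    (by linarith [japSq_pos p])
  rw [lapNum, norm_mul]
  linarith [mul_pos (japSq_pos p) (japSq_pos q)]

lemma norm_hessNum_le (i j : Fin 2) (p q : Freq) : ‖hessNum i j p q‖ ≤ 9 * (japSq p * japSq q) := by
  have h1 (l : Fin 2) : ‖dsym i p * dsym l p * (dsym j q * dsym l q)‖ ≤ japSq p * japSq q := by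
    rw [norm_mul]
    exact mul_le_mul (norm_dsym_mul_le _ _ _) (norm_dsym_mul_le _ _ _) (norm_nonneg _)
      (japSq_pos p).le
  have h2 : ‖(dsym 0 p ^ 2 + dsym 1 p ^ 2) * (dsym i q * dsym j q)‖ ≤
      2 * japSq p * japSq q := by
    rw [norm_mul]
    exact mul_le_mul (norm_lap_le p) (norm_dsym_mul_le _ _ _) (norm_nonneg _)
      (by linarith [japSq_pos p])
  have h3 : ‖dsym i p * dsym j q‖ ≤ japSq p * japSq q := by
    rw [norm_mul]
    exact mul_le_mul (norm_dsym_le _ _) (norm_dsym_le _ _) (norm_nonneg _) (japSq_pos p).le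
  have h4 := norm_add_le (dsym i p * dsym 0 p * (dsym j q * dsym 0 q))
    (dsym i p * dsym 1 p * (dsym j q * dsym 1 q))
  rw [hessNum]
  refine (norm_sub_le _ _).trans ?_
  have h5 := norm_sub_le
    (2 * (dsym i p * dsym 0 p * (dsym j q * dsym 0 q) +
      dsym i p * dsym 1 p * (dsym j q * dsym 1 q)))
    (2 * ((dsym 0 p ^ 2 + dsym 1 p ^ 2) * (dsym i q * dsym j q)))
  rw [norm_mul 2, norm_mul 2, RCLike.norm_ofNat] at h5
  linarith [h1 0, h1 1]

lemma norm_guntherNum_le (r : Fin 5) (p q : Freq) :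
    ‖guntherNum r p q‖ ≤ 9 * (japSq p * japSq q) := by
  have h (i j : Fin 2) : ‖-(1 / 2) * hessNum i j p q‖ ≤ 9 * (japSq p * japSq q) := by
    rw [norm_mul, norm_neg, norm_div, norm_one, RCLike.norm_ofNat]
    linarith [norm_hessNum_le i j p q, norm_nonneg (hessNum i j p q)]
  fin_cases r
  exacts [norm_lapNum_le 0 p q, norm_lapNum_le 1 p q, h 0 0, h 0 1, h 1 1]

/-- The inverse of 1 − Δ cancels one power of `japSq (p + q)`; the remaining power t − 1 ≥ 0 is
submultiplicative, and the numerator uses up exactly the factors `japSq p * japSq q` still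
available. Hence the quadratic term loses no derivatives. -/
lemma symbolBound_guntherSym {t : ℝ} (ht : 1 ≤ t) (r : Fin 5) :
    SymbolBound t 9 (guntherSym r) := fun p q => by
  have hJ (k : Freq) : japSq k ^ t = japSq k ^ (t - 1) * japSq k := by
    conv_rhs => rw [← Real.rpow_add_one (japSq_pos k).ne', sub_add_cancel]
  rw [guntherSym, norm_div, norm_real, Real.norm_of_nonneg (japSq_pos _).le, hJ (p + q), hJ p, hJ q]
  have h1 := japSq_add_rpow_le p q (sub_nonneg.2 ht)
  have h2 := mul_le_mul h1 (norm_guntherNum_le r p q) (norm_nonneg _)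
    (mul_pos (japSq_rpow_pos p _) (japSq_rpow_pos q _)).le
  have h3 : japSq (p + q) ^ (t - 1) * japSq (p + q) * (‖guntherNum r p q‖ / japSq (p + q)) =
      japSq (p + q) ^ (t - 1) * ‖guntherNum r p q‖ := by
    have := (japSq_pos (p + q)).ne'
    field_simp
  rw [h3]
  linarith

/-- Günther's identity. -/
lemma gunther_antisymm {i j : Fin 2} (hij : i ≤ j) (p q : Freq) :
    dsym i p * dsym j q + dsym i (p + q) * guntherSym (row₁ j) p q
        + dsym j (p + q) * guntherSym (row₁ i) p q - 2 * guntherSym (row₂ i j) p q =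
      -(dsym i q * dsym j p + dsym i (q + p) * guntherSym (row₁ j) q p
        + dsym j (q + p) * guntherSym (row₁ i) q p - 2 * guntherSym (row₂ i j) q p) := by
  have hJ : (japSq (p + q) : ℂ) ≠ 0 := ofReal_ne_zero.2 (japSq_pos _).ne'
  simp only [guntherSym, guntherNum_row₁, guntherNum_row₂ hij, add_comm q p]
  field_simp
  -- Without denominators, and with the weight written through the derivative symbols, what remains
  -- is a polynomial identity.
  rw [japSq_eq]
  simp only [lapNum, hessNum, dsym_add]
  ring

/-- The symbols of the two sides differ by the antisymmetric one of `gunther_antisymm`, which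
`conv_self_eq_zero` kills. The restriction `i ≤ j` reflects that `guntherNum` lists each mixed
second derivative once. -/
lemma conv_dsym_dsym {t : ℝ} (ht : 1 ≤ t) {c : Freq → ℂ} (hc : InWiener t c) {i j : Fin 2}
    (hij : i ≤ j) (k : Freq) :
    conv (fun _ _ => 1) (fun k => dsym i k * c k) (fun k => dsym j k * c k) k =
      -(dsym i k * conv (guntherSym (row₁ j)) c c k)
        - dsym j k * conv (guntherSym (row₁ i)) c c k
        + 2 * conv (guntherSym (row₂ i j)) c c k := by
  have hd (l : Fin 2) : InWiener 0 (fun k => dsym l k * c k) :=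
    InWiener.dsym_mul (hc.mono (by linarith)) l
  have s1 := (symbolBound_one le_rfl).summable_term (hd i) (hd j) k
  have s2 (r : Fin 5) := (symbolBound_guntherSym ht r).summable_term hc hc k
  have h0 := conv_self_eq_zero (gunther_antisymm hij) c k
  have h1 := (((s1.hasSum.add ((s2 (row₁ j)).hasSum.mul_left (dsym i k))).add
    ((s2 (row₁ i)).hasSum.mul_left (dsym j k))).sub
    ((s2 (row₂ i j)).hasSum.mul_left 2)).tsum_eq
  rw [conv] at h0
  have h2 : ∀ p : Freq, (dsym i p * dsym j (k - p)
      + dsym i (p + (k - p)) * guntherSym (row₁ j) p (k - p)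
      + dsym j (p + (k - p)) * guntherSym (row₁ i) p (k - p)
      - 2 * guntherSym (row₂ i j) p (k - p)) * (c p * c (k - p)) =
      1 * (dsym i p * c p * (dsym j (k - p) * c (k - p)))
      + dsym i k * (guntherSym (row₁ j) p (k - p) * (c p * c (k - p)))
      + dsym j k * (guntherSym (row₁ i) p (k - p) * (c p * c (k - p)))
      - 2 * (guntherSym (row₂ i j) p (k - p) * (c p * c (k - p))) := fun p => by
    rw [add_sub_cancel]; ring
  rw [tsum_congr h2, h1] at h0
  simp only [conv]
  linear_combination h0

/-- The product of the `i`-th derivatives of `c` and the `j`-th derivatives of `d`, summed over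
the components. -/
def gradDot (i j : Fin 2) (c d : Fin 5 → Freq → ℂ) (θ : T2) : ℂ :=
  ∑ a, synth (fun k => dsym i k * c a k) θ * synth (fun k => dsym j k * d a k) θ

lemma gradDot_self {t : ℝ} (ht : 1 ≤ t) {v : Fin 5 → Freq → ℂ} (hv : ∀ a, InWiener t (v a))
    {i j : Fin 2} (hij : i ≤ j) (θ : T2) :
    gradDot i j v v θ =
      -synth (fun k => dsym i k * convDot guntherSym v v (row₁ j) k) θ
        - synth (fun k => dsym j k * convDot guntherSym v v (row₁ i) k) θ
        + 2 * synth (convDot guntherSym v v (row₂ i j)) θ := by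
  have hd (l : Fin 2) (a : Fin 5) : Summable fun k => ‖dsym l k * v a k‖ :=
    (InWiener.dsym_mul ((hv a).mono (show (0 : ℝ) + 1 ≤ t by linarith)) l).summable_norm le_rfl
  have hU (r : Fin 5) (a : Fin 5) :=
    (symbolBound_guntherSym ht r).inWiener_conv (hv a) (hv a)
  have hW (r a : Fin 5) := (hU r a).summable_norm (zero_le_one.trans ht)
  have hdU (l : Fin 2) (r a : Fin 5) :
      Summable fun k => ‖dsym l k * conv (guntherSym r) (v a) (v a) k‖ :=
    (InWiener.dsym_mul ((hU r a).mono (show (0 : ℝ) + 1 ≤ t by linarith)) l).summable_norm le_rfl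
  simp only [gradDot, convDot, Finset.mul_sum]
  rw [synth_sum _ (hdU i (row₁ j)), synth_sum _ (hdU j (row₁ i)),
    show convDot guntherSym v v (row₂ i j) =
      (fun k => ∑ a, (fun a => conv (guntherSym (row₂ i j)) (v a) (v a)) a k) from rfl,
    synth_sum _ (hW (row₂ i j)), Finset.mul_sum, ← Finset.sum_neg_distrib,
    ← Finset.sum_sub_distrib, ← Finset.sum_add_distrib]
  refine Finset.sum_congr rfl fun a _ => ?_
  rw [synth_mul_synth (hd i a) (hd j a)]
  have e : conv (fun _ _ => 1) (fun k => dsym i k * v a k) (fun k => dsym j k * v a k) =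
      fun k => ((-1) * (dsym i k * conv (guntherSym (row₁ j)) (v a) (v a) k)
        + (-1) * (dsym j k * conv (guntherSym (row₁ i)) (v a) (v a) k))
        + 2 * conv (guntherSym (row₂ i j)) (v a) (v a) k := by
    funext k
    rw [conv_dsym_dsym ht (hv a) hij]; ring
  have n1 {c : Freq → ℂ} (z : ℂ) (hc : Summable fun k => ‖c k‖) :
      Summable fun k => ‖z * c k‖ := by simpa using hc.mul_left ‖z‖
  have n2 {c d : Freq → ℂ} (hc : Summable fun k => ‖c k‖) (hd : Summable fun k => ‖d k‖) :
      Summable fun k => ‖c k + d k‖ :=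
    (hc.add hd).of_nonneg_of_le (fun _ => norm_nonneg _) fun _ => norm_add_le _ _
  rw [e, synth_add (n2 (n1 _ (hdU i (row₁ j) a)) (n1 _ (hdU j (row₁ i) a))) (n1 _ (hW _ a)),
    synth_add (n1 _ (hdU i (row₁ j) a)) (n1 _ (hdU j (row₁ i) a)), synth_const_mul,
    synth_const_mul, synth_const_mul]
  ring

/-- The linear terms of Günther's equations. -/
lemma gradDot_add_gradDot {x v : Fin 5 → Freq → ℂ} {U : Fin 2 → Freq → ℂ}
    (hx : ∀ a, InWiener 2 (x a)) (hv : ∀ a, InWiener 1 (v a)) (hU : ∀ i, InWiener 1 (U i))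
    (h : ∀ i θ, ∑ a, synth (fun k => dsym i k * x a k) θ * synth (v a) θ = synth (U i) θ)
    (i j : Fin 2) (θ : T2) :
    gradDot i j x v θ + gradDot j i x v θ =
      synth (fun k => dsym j k * U i k) θ + synth (fun k => dsym i k * U j k) θ
        - 2 * ∑ a, synth (fun k => dsym i k * dsym j k * x a k) θ * synth (v a) θ := by
  have hd (i j : Fin 2) : gradDot i j x v θ = synth (fun k => dsym j k * U i k) θ
      - ∑ a, synth (fun k => dsym j k * (dsym i k * x a k)) θ * synth (v a) θ := by
    have hx' (a : Fin 5) : InWiener 1 (fun k => dsym i k * x a k) :=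
      InWiener.dsym_mul ((hx a).mono (by norm_num)) i
    -- Differentiating ∂_i x·v = U_i in direction j moves the derivative off v: ∂_i x·∂_j v = ∂_j
    -- U_i − ∂_i∂_j x·v.
    have h1 := HasDerivAt.fun_sum (u := Finset.univ) fun a (_ : a ∈ Finset.univ) =>
      (hasDerivAt_synth (hx' a) j θ).mul (hasDerivAt_synth (hv a) j θ)
    have h2 := hasDerivAt_synth (hU i) j θ
    have e : (fun t : ℝ => ∑ a, synth (fun k => dsym i k * x a k)
        (θ + Pi.single j (t : UnitAddCircle)) * synth (v a) (θ + Pi.single j (t : UnitAddCircle)))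
        = fun t : ℝ => synth (U i) (θ + Pi.single j (t : UnitAddCircle)) :=
      funext fun t => h i _
    simp only [Pi.mul_apply] at h1
    rw [e] at h1
    have h3 := h1.unique h2
    simp only [AddCircle.coe_zero, Pi.single_zero, add_zero, Finset.sum_add_distrib] at h3
    rw [gradDot, ← h3]
    ring
  rw [hd i j, hd j i]
  have e1 : ∀ a, (fun k => dsym j k * (dsym i k * x a k)) =
      fun k => dsym i k * dsym j k * x a k := fun a => by funext k; ring
  have e2 : ∀ a, (fun k => dsym i k * (dsym j k * x a k)) =
      fun k => dsym i k * dsym j k * x a k := fun a => by funext k; ring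
  simp only [e1, e2]
  ring

/-- The right-hand sides of the five equations. -/
def guntherRhs (h : Fin 2 → Fin 2 → Freq → ℂ) (r : Fin 5) (k : Freq) : ℂ :=
  -(1 / 2) * (![fun _ => 0, fun _ => 0, h 0 0, h 0 1, h 1 1] : Fin 5 → Freq → ℂ) r k

lemma guntherRhs_row₁ (h : Fin 2 → Fin 2 → Freq → ℂ) (i : Fin 2) (k : Freq) :
    guntherRhs h (row₁ i) k = 0 := by
  fin_cases i <;> simp [guntherRhs, row₁]

lemma guntherRhs_row₂ (h : Fin 2 → Fin 2 → Freq → ℂ) {i j : Fin 2} (hij : i ≤ j) (k : Freq) :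
    guntherRhs h (row₂ i j) k = -(1 / 2) * h i j k := by
  fin_cases i <;> fin_cases j <;> first | rfl | exact absurd hij (by decide)

/-- Here m is the inverse of the matrix of first and second derivatives of x. A fixed point solves
the five pointwise equations; adding their consequence `gradDot_add_gradDot` to `gradDot_self`
cancels all the N-terms and leaves h. -/
theorem exists_perturbation {t : ℝ} (ht : 1 ≤ t) {x : Fin 5 → Freq → ℂ}
    (hx : ∀ a s, InWiener s (x a)) {m : Fin 5 → Fin 5 → Freq → ℂ}
    (hm : ∀ a r, InWiener t (m a r)) (hmh : ∀ a r, IsHermSeq (m a r))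
    (hinv : ∀ r r' θ, ∑ a, synth (fun k => oscSym r k * x a k) θ * synth (m a r') θ =
      if r = r' then 1 else 0) :
    ∃ ε > 0, ∃ C > 0, ∀ (h : Fin 2 → Fin 2 → Freq → ℂ) (D : ℝ), (∀ i j, InWiener t (h i j)) →
      (∀ i j, IsHermSeq (h i j)) → (∀ i j, h i j = h j i) → (∀ i j, wienerNorm t (h i j) ≤ D) →
      D ≤ ε →
      ∃ v : Fin 5 → Freq → ℂ, (∀ a, InWiener t (v a)) ∧ (∀ a, IsHermSeq (v a)) ∧
        (∀ a, wienerNorm t (v a) ≤ C * D) ∧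
        ∀ i j θ, gradDot i j x v θ + gradDot j i x v θ + gradDot i j v v θ = synth (h i j) θ := by
  have ht0 : 0 ≤ t := zero_le_one.trans ht
  have hσ := symbolBound_guntherSym ht
  obtain ⟨ε, hε, C, hC, H⟩ := exists_wiener_fixedPoint ht0 hm hmh (by norm_num) hσ guntherSym_neg
  refine ⟨ε, hε, C, hC, fun h D hh hherm hsymm hD hDε => ?_⟩
  have hD0 : 0 ≤ D := (wienerNorm_nonneg t _).trans (hD 0 0)
  have hη (r : Fin 5) : InWiener t (guntherRhs h r) := by
    refine InWiener.const_mul ?_ _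
    fin_cases r
    exacts [by simp [InWiener], by simp [InWiener], hh 0 0, hh 0 1, hh 1 1]
  have hηh (r : Fin 5) : IsHermSeq (guntherRhs h r) := fun k => by
    fin_cases r <;> simp [guntherRhs, hherm 0 0 k, hherm 0 1 k, hherm 1 1 k, Complex.conj_ofNat]
  have hηD (r : Fin 5) : wienerNorm t (guntherRhs h r) ≤ D := by
    have hn (c : Freq → ℂ) : wienerNorm t (fun k => -(1 / 2) * c k) = 1 / 2 * wienerNorm t c := by
      rw [wienerNorm, wienerNorm, ← tsum_mul_left]
      refine tsum_congr fun k => ?_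
      rw [norm_mul, norm_neg, norm_div, norm_one, RCLike.norm_ofNat]
      ring
    have hz : wienerNorm t (fun _ => 0) ≤ D := by simpa [wienerNorm] using hD0
    have key : ∀ c : Freq → ℂ, wienerNorm t c ≤ D → wienerNorm t (fun k => -(1 / 2) * c k) ≤ D :=
      fun c hc => by rw [hn]; linarith [wienerNorm_nonneg t c]
    refine key _ ?_
    fin_cases r
    exacts [hz, hz, hD 0 0, hD 0 1, hD 1 1]
  obtain ⟨v, hv, hvh, hvn, hfix⟩ := H (guntherRhs h) D hη hηh hηD hD0 hDε
  refine ⟨v, hv, hvh, hvn, ?_⟩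
  have hU := inWiener_convDot hσ hv hv
  have hs {c : Freq → ℂ} (hc : InWiener t c) := hc.summable_norm ht0
  have hsv (a : Fin 5) (θ : T2) : synth (v a) θ =
      ∑ r, synth (m a r) θ * (synth (guntherRhs h r) θ + synth (convDot guntherSym v v r) θ) := by
    conv_lhs => rw [hfix]
    have := synth_sum Finset.univ (c := fun r => conv (fun _ _ => 1) (m a r)
      (fun k => guntherRhs h r k + convDot guntherSym v v r k))
      (fun r => hs ((symbolBound_one ht0).inWiener_conv (hm a r) ((hη r).add (hU r)))) θ
    refine this.trans (Finset.sum_congr rfl fun r _ => ?_)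
    rw [← synth_mul_synth (hs (hm a r)) (hs ((hη r).add (hU r))), synth_add (hs (hη r)) (hs (hU r))]
  -- Multiplying the fixed point equation by the matrix inverse to m recovers the five linear
  -- equations.
  have hosc (r : Fin 5) (θ : T2) : ∑ a, synth (fun k => oscSym r k * x a k) θ * synth (v a) θ =
      synth (guntherRhs h r) θ + synth (convDot guntherSym v v r) θ := by
    simp only [hsv, Finset.mul_sum, ← mul_assoc]
    rw [Finset.sum_comm]
    simp only [← Finset.sum_mul, hinv, ite_mul, one_mul, zero_mul]
    simp
  have h1 (i : Fin 2) (θ : T2) : ∑ a, synth (fun k => dsym i k * x a k) θ * synth (v a) θ =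
      synth (convDot guntherSym v v (row₁ i)) θ := by
    have := hosc (row₁ i) θ
    have e : synth (guntherRhs h (row₁ i)) θ = 0 := by simp [synth, guntherRhs_row₁]
    simpa only [oscSym_row₁, e, zero_add] using this
  have main : ∀ i j : Fin 2, i ≤ j → ∀ θ,
      gradDot i j x v θ + gradDot j i x v θ + gradDot i j v v θ = synth (h i j) θ := by
    intro i j hij θ
    rw [gradDot_add_gradDot (U := fun i => convDot guntherSym v v (row₁ i)) (fun a => hx a 2)
      (fun a => (hv a).mono ht) (fun i => (hU _).mono ht) h1 i j θ, gradDot_self ht hv hij θ]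
    have h2 := hosc (row₂ i j) θ
    have e : synth (guntherRhs h (row₂ i j)) θ = -(1 / 2) * synth (h i j) θ := by
      rw [← synth_const_mul]
      congr 1
      funext k
      exact guntherRhs_row₂ h hij k
    simp only [oscSym_row₂, e] at h2
    rw [h2]
    ring
  intro i j θ
  rcases le_total i j with hij | hij
  · exact main i j hij θ
  -- The entries below the diagonal follow from the symmetry of h and of the left-hand side.
  · rw [hsymm, ← main j i hij θ]
    have : gradDot i j v v θ = gradDot j i v v θ := Finset.sum_congr rfl fun a _ => mul_comm _ _
    rw [this]; ring

/-! ### Sobolev norms -/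

lemma sobolevTerm_eq (s : ℝ) (u : T2 → ℝ) (k : Freq) :
    sobolevTerm s u k = japSq k ^ s * ‖mFourierCoeff (fun θ => (u θ : ℂ)) k‖ ^ 2 := rfl

lemma sobolevTerm_nonneg (s : ℝ) (u : T2 → ℝ) (k : Freq) : 0 ≤ sobolevTerm s u k :=
  mul_nonneg (japSq_rpow_pos k s).le (by positivity)

/-- Cauchy–Schwarz for the factors `japSq k ^ (-(s - 2 * t) / 2)` and `japSq k ^ (s / 2) * ‖c k‖`;
in dimension two the first is square-summable when s − 2t > 1. -/
lemma inWiener_and_wienerNorm_le {s t : ℝ} (hst : 1 < s - 2 * t) {u : T2 → ℝ}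
    (hu : Summable (sobolevTerm s u)) :
    InWiener t (mFourierCoeff fun θ => (u θ : ℂ)) ∧
      wienerNorm t (mFourierCoeff fun θ => (u θ : ℂ)) ≤
        Real.sqrt (∑' k : Freq, japSq k ^ (-(s - 2 * t))) *
          Real.sqrt (∑' k, sobolevTerm s u k) := by
  set c := mFourierCoeff fun θ => (u θ : ℂ)
  let f (k : Freq) : ℝ := japSq k ^ (-(s - 2 * t) / 2)
  let g (k : Freq) : ℝ := japSq k ^ (s / 2) * ‖c k‖
  have hf2 (k : Freq) : f k ^ (2 : ℝ) = japSq k ^ (-(s - 2 * t)) := by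
    simp only [f]
    rw [← Real.rpow_mul (japSq_pos k).le]
    congr 1; ring
  have hg2 (k : Freq) : g k ^ (2 : ℝ) = sobolevTerm s u k := by
    simp only [g]
    rw [sobolevTerm_eq, Real.rpow_two, mul_pow, ← Real.rpow_two, ← Real.rpow_mul (japSq_pos k).le]
    congr 2; ring
  have hfg (k : Freq) : f k * g k = japSq k ^ t * ‖c k‖ := by
    simp only [f, g]
    rw [← mul_assoc, ← Real.rpow_add (japSq_pos k)]
    congr 2; ring
  have h2 : (2 : ℝ).HolderConjugate 2 := Real.HolderConjugate.two_two
  have h := Real.summable_and_inner_le_Lp_mul_Lq_tsum_of_nonneg h2 (f := f) (g := g)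
    (fun k => (japSq_rpow_pos k _).le)
    (fun k => mul_nonneg (japSq_rpow_pos k _).le (norm_nonneg _))
    (by simpa only [hf2] using summable_japSq_rpow_neg hst) (by simpa only [hg2] using hu)
  simp only [hf2, hg2, hfg, ← Real.sqrt_eq_rpow] at h
  exact h

lemma mFourierCoeff_re_synth {c : Freq → ℂ} (hc : Summable fun k => ‖c k‖) (hh : IsHermSeq c)
    {u : T2 → ℝ} (hu : ∀ θ, u θ = (synth c θ).re) :
    (mFourierCoeff fun θ => (u θ : ℂ)) = c := by
  have : (fun θ => (u θ : ℂ)) = synth c := funext fun θ => by rw [hu, ofReal_synth_re hh]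
  rw [this]
  exact funext (mFourierCoeff_synth hc)

/-- This is ∑ a² ≤ (∑ a)² for the weighted moduli a, since twice the exponent t dominates s. -/
lemma summable_sobolevTerm_and_tsum_le {s t : ℝ} (ht : 0 ≤ t) (hst : s ≤ 2 * t) {c : Freq → ℂ}
    (hc : InWiener t c) (hh : IsHermSeq c) {u : T2 → ℝ} (hu : ∀ θ, u θ = (synth c θ).re) :
    Summable (sobolevTerm s u) ∧ ∑' k, sobolevTerm s u k ≤ wienerNorm t c ^ 2 := by
  have hle (k : Freq) : sobolevTerm s u k ≤ wienerNorm t c * (japSq k ^ t * ‖c k‖) := by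
    rw [sobolevTerm_eq, mFourierCoeff_re_synth (hc.summable_norm ht) hh hu]
    have h1 : japSq k ^ s ≤ japSq k ^ t * japSq k ^ t := by
      rw [← Real.rpow_add (japSq_pos k)]
      exact Real.rpow_le_rpow_of_exponent_le (one_le_japSq k) (by linarith)
    have h0 : 0 ≤ japSq k ^ t * ‖c k‖ := mul_nonneg (japSq_rpow_pos k t).le (norm_nonneg _)
    have h2 : japSq k ^ t * ‖c k‖ ≤ wienerNorm t c :=
      Summable.le_tsum hc k fun j _ => mul_nonneg (japSq_rpow_pos j t).le (norm_nonneg _)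
    calc japSq k ^ s * ‖c k‖ ^ 2 ≤ japSq k ^ t * japSq k ^ t * ‖c k‖ ^ 2 := by gcongr
      _ = (japSq k ^ t * ‖c k‖) * (japSq k ^ t * ‖c k‖) := by ring
      _ ≤ wienerNorm t c * (japSq k ^ t * ‖c k‖) := mul_le_mul_of_nonneg_right h2 h0
  have hs : Summable fun k => wienerNorm t c * (japSq k ^ t * ‖c k‖) := Summable.mul_left _ hc
  have hsum := hs.of_nonneg_of_le (sobolevTerm_nonneg s u) hle
  refine ⟨hsum, (hsum.tsum_le_tsum hle hs).trans_eq ?_⟩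
  rw [tsum_mul_left, sq]
  rfl

lemma memLp_of_continuous {u : T2 → ℝ} (hu : Continuous u) : MemLp u 2 torusMeasure := by
  obtain ⟨B, hB⟩ := (isCompact_univ.image hu.norm).bddAbove
  exact MemLp.of_bound hu.aestronglyMeasurable B (ae_of_all _ fun θ => hB ⟨θ, trivial, rfl⟩)

lemma memH_of_inWiener {ι : Type*} {s t : ℝ} (ht : 0 ≤ t) (hst : s ≤ 2 * t)
    {c : ι → Freq → ℂ} (hc : ∀ a, InWiener t (c a)) (hh : ∀ a, IsHermSeq (c a))
    {u : ι → T2 → ℝ} (hu : ∀ a θ, u a θ = (synth (c a) θ).re) : MemH s u := fun a => by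
  refine ⟨memLp_of_continuous ?_, (summable_sobolevTerm_and_tsum_le ht hst (hc a) (hh a)
    (hu a)).1⟩
  rw [funext (hu a)]
  exact continuous_re.comp (continuous_synth ((hc a).summable_norm ht))

lemma normH_le {ι : Type*} [Fintype ι] {s t D : ℝ} (ht : 0 ≤ t) (hst : s ≤ 2 * t)
    {c : ι → Freq → ℂ} (hc : ∀ a, InWiener t (c a)) (hh : ∀ a, IsHermSeq (c a))
    {u : ι → T2 → ℝ} (hu : ∀ a θ, u a θ = (synth (c a) θ).re) (hD : 0 ≤ D)
    (hcD : ∀ a, wienerNorm t (c a) ≤ D) : normH s u ≤ Real.sqrt (Fintype.card ι) * D := by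
  rw [normH, ← Real.sqrt_sq hD, ← Real.sqrt_mul (by positivity)]
  refine Real.sqrt_le_sqrt ?_
  calc ∑ a, ∑' k, sobolevTerm s (u a) k ≤ ∑ _a : ι, D ^ 2 := by
        refine Finset.sum_le_sum fun a _ =>
          (summable_sobolevTerm_and_tsum_le ht hst (hc a) (hh a) (hu a)).2.trans ?_
        exact pow_le_pow_left₀ (wienerNorm_nonneg t _) (hcD a) 2
    _ = Fintype.card ι * D ^ 2 := by simp

lemma sqrt_tsum_le_normH {ι : Type*} [Fintype ι] (s : ℝ) (u : ι → T2 → ℝ) (a : ι) :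
    Real.sqrt (∑' k, sobolevTerm s (u a) k) ≤ normH s u :=
  Real.sqrt_le_sqrt (Finset.single_le_sum (f := fun a => ∑' k, sobolevTerm s (u a) k)
    (fun a _ => tsum_nonneg (sobolevTerm_nonneg s (u a))) (Finset.mem_univ a))

lemma IsC.ofReal {n : ℕ∞} {u : T2 → ℝ} (hu : IsC n u) : IsC n (fun θ => (u θ : ℂ)) :=
  ofRealCLM.contDiff.comp hu

lemma IsC.eq_re_synth {u : T2 → ℝ} (hu : IsC ⊤ u) (θ : T2) :
    u θ = (synth (mFourierCoeff fun θ => (u θ : ℂ)) θ).re := by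
  rw [← hu.ofReal.eq_synth θ, ofReal_re]

lemma summable_sobolevTerm_sub {s : ℝ} {u w : T2 → ℝ} (hu : MemLp u 2 torusMeasure)
    (hu' : Summable (sobolevTerm s u)) (hw : IsC ⊤ w) :
    Summable (sobolevTerm s (fun θ => u θ - w θ)) := by
  have hui : Integrable (fun θ => (u θ : ℂ)) torusMeasure :=
    (hu.integrable one_le_two).ofReal
  have hwi := integrable_of_continuous hw.ofReal.continuous
  have hw' : Summable (sobolevTerm s w) := by
    have h0 : 0 ≤ max (s / 2) 0 := le_max_right _ _
    exact (summable_sobolevTerm_and_tsum_le h0 (by linarith [le_max_left (s / 2) 0])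
      (hw.ofReal.inWiener _) (isHermSeq_mFourierCoeff w) hw.eq_re_synth).1
  refine ((hu'.add hw').mul_left 2).of_nonneg_of_le (sobolevTerm_nonneg _ _) fun k => ?_
  simp only [sobolevTerm_eq, ofReal_sub]
  rw [mFourierCoeff_sub hui hwi, ← mul_add, mul_left_comm]
  refine mul_le_mul_of_nonneg_left ?_ (japSq_rpow_pos k s).le
  set a := mFourierCoeff (fun θ => (u θ : ℂ)) k
  set b := mFourierCoeff (fun θ => (w θ : ℂ)) k
  have h1 : ‖a - b‖ ^ 2 ≤ (‖a‖ + ‖b‖) ^ 2 := by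
    gcongr
    exact norm_sub_le a b
  nlinarith [sq_nonneg (‖a‖ - ‖b‖)]

/-! ### Maps into `ℝ⁵` -/

lemma pd_apply_of_hasDerivAt {y : T2 → E5} {i : Fin 2} {θ : T2} {d : Fin 5 → ℝ}
    (h : ∀ a, HasDerivAt (fun t : ℝ => y (θ + Pi.single i (t : UnitAddCircle)) a) (d a) 0)
    (a : Fin 5) : pd i y θ a = d a := by
  have h1 : DifferentiableAt ℝ (fun t : ℝ => y (θ + Pi.single i (t : UnitAddCircle))) 0 :=
    differentiableAt_euclidean.2 fun a => (h a).differentiableAt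
  have h2 := (EuclideanSpace.proj (𝕜 := ℝ) a : E5 →L[ℝ] ℝ).hasFDerivAt.comp_hasDerivAt (0 : ℝ)
    h1.hasDerivAt
  exact h2.unique (h a)

lemma IsHermSeq.dsym_mul {c : Freq → ℂ} (hc : IsHermSeq c) (i : Fin 2) :
    IsHermSeq (fun k => dsym i k * c k) := fun k => by
  simp only [dsym_neg, hc k, map_mul]

/-- The map `y` has the Fourier coefficients `c`. -/
def HasCoeffs (y : T2 → E5) (c : Fin 5 → Freq → ℂ) : Prop :=
  (∀ a, IsHermSeq (c a)) ∧ ∀ θ a, y θ a = (synth (c a) θ).re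

lemma HasCoeffs.coe_eq {y : T2 → E5} {c : Fin 5 → Freq → ℂ} (h : HasCoeffs y c) (θ : T2)
    (a : Fin 5) : ((y θ a : ℝ) : ℂ) = synth (c a) θ := by
  rw [h.2, ofReal_synth_re (h.1 a)]

lemma HasCoeffs.pd {y : T2 → E5} {c : Fin 5 → Freq → ℂ} (h : HasCoeffs y c)
    (hc : ∀ a, InWiener 1 (c a)) (i : Fin 2) :
    HasCoeffs (pd i y) (fun a k => dsym i k * c a k) := by
  refine ⟨fun a => (h.1 a).dsym_mul i, fun θ a => ?_⟩
  refine pd_apply_of_hasDerivAt (d := fun a => (synth (fun k => dsym i k * c a k) θ).re)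
    (fun a => ?_) a
  simp only [h.2]
  exact reCLM.hasFDerivAt.comp_hasDerivAt (0 : ℝ) (hasDerivAt_synth (hc a) i θ)

lemma HasCoeffs.inducedMetric_eq {y : T2 → E5} {c : Fin 5 → Freq → ℂ} (h : HasCoeffs y c)
    (hc : ∀ a, InWiener 1 (c a)) (i j : Fin 2) (θ : T2) :
    ((inducedMetric y θ i j : ℝ) : ℂ) = gradDot i j c c θ := by
  have : inducedMetric y θ i j = ∑ a, TorusIsometric.pd i y θ a * TorusIsometric.pd j y θ a := by
    simp only [inducedMetric, Matrix.of_apply, PiLp.inner_apply]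
    exact Finset.sum_congr rfl fun a _ => mul_comm _ _
  rw [this, gradDot]
  push_cast
  exact Finset.sum_congr rfl fun a _ => by rw [(h.pd hc i).coe_eq, (h.pd hc j).coe_eq]

lemma HasCoeffs.oscMatrix_eq {y : T2 → E5} {c : Fin 5 → Freq → ℂ} (h : HasCoeffs y c)
    (hc : ∀ a, InWiener 2 (c a)) (r a : Fin 5) (θ : T2) :
    ((oscMatrix y θ r a : ℝ) : ℂ) = synth (fun k => oscSym r k * c a k) θ := by
  have hc1 (b : Fin 5) : InWiener 1 (c b) := (hc b).mono one_le_two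
  have hd (i : Fin 2) (a : Fin 5) : InWiener 1 (fun k => dsym i k * c a k) :=
    InWiener.dsym_mul ((hc a).mono (by norm_num)) i
  have h2 (i j : Fin 2) : ((TorusIsometric.pd i (TorusIsometric.pd j y) θ a : ℝ) : ℂ) =
      synth (fun k => dsym i k * dsym j k * c a k) θ := by
    rw [((h.pd hc1 j).pd (hd j) i).coe_eq]
    simp only [mul_assoc]
  fin_cases r
  exacts [(h.pd hc1 0).coe_eq θ a, (h.pd hc1 1).coe_eq θ a, h2 0 0, h2 0 1, h2 1 1]

lemma HasCoeffs.isC_two {y : T2 → E5} {c : Fin 5 → Freq → ℂ} (h : HasCoeffs y c)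
    (hc : ∀ a, InWiener 1 (c a)) : IsC 2 y := by
  refine contDiff_euclidean.2 fun a => ?_
  have e : (lift y · a) = fun p => reCLM (lift (synth (c a)) p) :=
    funext fun p => h.2 _ a
  rw [e]
  exact reCLM.contDiff.comp (contDiff_lift_synth (hc a))

lemma IsC.coord {n : ℕ∞} {y : T2 → E5} (hy : IsC n y) (a : Fin 5) : IsC n (fun θ => y θ a) :=
  contDiff_euclidean.1 hy a

lemma IsC.hasCoeffs {y : T2 → E5} (hy : IsC ⊤ y) :
    HasCoeffs y (fun a => mFourierCoeff fun θ => (y θ a : ℂ)) :=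
  ⟨fun _ => isHermSeq_mFourierCoeff _, fun θ a => (hy.coord a).eq_re_synth θ⟩

lemma IsC.oscMatrix {y : T2 → E5} (hy : IsC ⊤ y) (r a : Fin 5) :
    IsC ⊤ (fun θ => oscMatrix y θ r a) := by
  have h2 (i j : Fin 2) := ((hy.pd j).pd i).coord a
  fin_cases r
  exacts [(hy.pd 0).coord a, (hy.pd 1).coord a, h2 0 0, h2 0 1, h2 1 1]

end TorusIsometric

/-! ### Smooth dependence of the inverse matrix. -/

section

variable {F : Type*} [NormedAddCommGroup F] [NormedSpace ℝ F] {n : Type*} [Fintype n]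
  [DecidableEq n] {N : WithTop ℕ∞} {A : F → Matrix n n ℝ}

lemma ContDiff.matrix_det (hA : ∀ i j, ContDiff ℝ N fun p => A p i j) :
    ContDiff ℝ N fun p => (A p).det := by
  simp only [Matrix.det_apply']
  exact ContDiff.sum fun σ _ => contDiff_const.mul (contDiff_prod fun i _ => hA _ _)

/-- By Cramer's rule each entry is a polynomial in the entries of A divided by a determinant that
never vanishes. -/
lemma ContDiff.matrix_inv (hA : ∀ i j, ContDiff ℝ N fun p => A p i j)
    (hdet : ∀ p, (A p).det ≠ 0) (i j : n) : ContDiff ℝ N fun p => (A p)⁻¹ i j := by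
  simp only [Matrix.inv_def, Matrix.smul_apply, Ring.inverse_eq_inv', smul_eq_mul,
    Matrix.adjugate_apply]
  refine ((ContDiff.matrix_det hA).inv hdet).mul (ContDiff.matrix_det fun a b => ?_)
  by_cases h : a = j
  · subst h
    simpa using contDiff_const
  · simpa [Matrix.updateRow_ne h] using hA a b

end

namespace TorusIsometric

open UnitAddTorus MeasureTheory Complex ComplexConjugate

/-- The inverse of `oscMatrix x₀` is smooth, so its coefficients lie in every weighted space and
multiplication by it is bounded whatever t is. -/
lemma exists_inverse_coeffs {x₀ : T2 → E5} (hx₀ : IsC ⊤ x₀)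
    (hdet : ∀ θ, (oscMatrix x₀ θ).det ≠ 0) :
    ∃ m : Fin 5 → Fin 5 → Freq → ℂ, (∀ t a r, InWiener t (m a r)) ∧ (∀ a r, IsHermSeq (m a r)) ∧
      ∀ r r' θ, ∑ a, synth (fun k => oscSym r k * mFourierCoeff (fun θ => (x₀ θ a : ℂ)) k) θ *
        synth (m a r') θ = if r = r' then 1 else 0 := by
  have hM (a r : Fin 5) : IsC ⊤ (fun θ => (oscMatrix x₀ θ)⁻¹ a r) :=
    ContDiff.matrix_inv (A := fun p => oscMatrix x₀ (proj p)) (fun i j => hx₀.oscMatrix i j)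
      (fun p => hdet _) a r
  refine ⟨fun a r => mFourierCoeff fun θ => ((oscMatrix x₀ θ)⁻¹ a r : ℂ),
    fun t a r => (hM a r).ofReal.inWiener t, fun a r => isHermSeq_mFourierCoeff _,
    fun r r' θ => ?_⟩
  have h1 := fun a => hx₀.hasCoeffs.oscMatrix_eq
    (fun a => (hx₀.coord a).ofReal.inWiener 2) r a θ
  have h2 := fun a => (hM a r').ofReal.eq_synth θ
  simp only [← h1, ← h2]
  have h3 : (oscMatrix x₀ θ * (oscMatrix x₀ θ)⁻¹) r r' = (1 : Matrix (Fin 5) (Fin 5) ℝ) r r' := by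
    rw [Matrix.mul_nonsing_inv _ (hdet θ).isUnit]
  rw [Matrix.mul_apply, Matrix.one_apply] at h3
  have h4 := congrArg ofReal h3
  simp only [ofReal_sum, ofReal_mul] at h4
  rw [h4]
  split_ifs <;> simp

lemma gradDot_add_self {x v : Fin 5 → Freq → ℂ} (hx : ∀ a, InWiener 1 (x a))
    (hv : ∀ a, InWiener 1 (v a)) (i j : Fin 2) (θ : T2) :
    gradDot i j (fun a k => x a k + v a k) (fun a k => x a k + v a k) θ =
      gradDot i j x x θ + (gradDot i j x v θ + gradDot j i x v θ + gradDot i j v v θ) := by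
  have hd {c : Freq → ℂ} (hc : InWiener 1 c) (l : Fin 2) : Summable fun k => ‖dsym l k * c k‖ :=
    (InWiener.dsym_mul (hc.mono (by norm_num : (0 : ℝ) + 1 ≤ 1)) l).summable_norm le_rfl
  have hs (l : Fin 2) (a : Fin 5) : synth (fun k => dsym l k * (x a k + v a k)) θ =
      synth (fun k => dsym l k * x a k) θ + synth (fun k => dsym l k * v a k) θ := by
    simp only [mul_add]
    exact synth_add (hd (hx a) l) (hd (hv a) l) θ
  simp only [gradDot, hs, ← Finset.sum_add_distrib]
  exact Finset.sum_congr rfl fun a _ => by ring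

lemma inducedMetric_symm (x : T2 → E5) (θ : T2) (i j : Fin 2) :
    inducedMetric x θ i j = inducedMetric x θ j i :=
  real_inner_comm (pd j x θ) (pd i x θ)

end TorusIsometric

end

/-! ### Conclusion: choice of exponents and constants. -/

open TorusIsometric in
theorem mainTheorem7
    (x₀ : T2 → E5) (g₀ : T2 → Matrix (Fin 2) (Fin 2) ℝ)
    (hx₀ : IsC (⊤ : ℕ∞) x₀) (hg₀ : ∀ p, IsC (⊤ : ℕ∞) (entries g₀ p))
    (hiso : ∀ θ, inducedMetric x₀ θ = g₀ θ)
    (hdet : ∀ θ, (oscMatrix x₀ θ).det ≠ 0)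
    (δ μ α : ℝ) (hμ : 3 < μ) (hδ : μ < δ) (hα : α < δ - μ) :
    ∃ ρ : ℝ, 0 < ρ ∧ ∃ C : ℝ, 0 < C ∧
      ∀ g : T2 → Matrix (Fin 2) (Fin 2) ℝ, (∀ θ, (g θ).IsSymm) →
        MemH (δ + μ - 1) (entries g) →
        normH (δ + μ - 1) (entries (g - g₀)) ≤ ρ →
        ∃ x : T2 → E5, IsC 2 x ∧ MemH μ (coords x) ∧ MemH (α + μ) (coords x) ∧
          (∀ᵐ θ ∂torusMeasure, inducedMetric x θ = g θ) ∧
          normH μ (coords (x - x₀)) ≤ 1 ∧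
          normH (μ + α) (coords (x - x₀)) ≤ C * normH (μ + δ - 1) (entries (g - g₀)) := by
  -- This t is the smallest for which the weighted space lies in H^δ by
  -- `summable_sobolevTerm_and_tsum_le`; it leaves s − 2t = μ − 1 > 1 for the embedding of the data.
  set t : ℝ := δ / 2 with ht_def
  have ht : 1 ≤ t := by linarith
  have ht0 : 0 ≤ t := by linarith
  set s : ℝ := δ + μ - 1 with hs_def
  have hs' : μ + δ - 1 = s := by ring
  have hst : 1 < s - 2 * t := by linarith
  let ξ (a : Fin 5) : Freq → ℂ := UnitAddTorus.mFourierCoeff fun θ => (x₀ θ a : ℂ)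
  have hξ (a : Fin 5) (r : ℝ) : InWiener r (ξ a) := (hx₀.coord a).ofReal.inWiener r
  have hξc : HasCoeffs x₀ ξ := hx₀.hasCoeffs
  obtain ⟨m, hm, hmh, hinv⟩ := exists_inverse_coeffs hx₀ hdet
  obtain ⟨ε, hε, C, hC, H⟩ := exists_perturbation ht hξ (hm t) hmh hinv
  set L : ℝ := Real.sqrt (∑' k : Freq, japSq k ^ (-(s - 2 * t))) + 1 with hL_def
  have hL : 0 < L := by positivity
  set R : ℝ := Real.sqrt (Fintype.card (Fin 5))
  have hR : 0 < R := Real.sqrt_pos.2 (by simp)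
  -- The first bound puts h within reach of the fixed point theorem; the second turns the linear
  -- estimate into ‖x − x⁰‖_μ ≤ 1.
  refine ⟨min (ε / L) (1 / (R * C * L)), by positivity, R * C * L, by positivity, ?_⟩
  intro g hgs hg hgρ
  rw [hs']
  set n : ℝ := normH s (entries (g - g₀))
  have hn : 0 ≤ n := Real.sqrt_nonneg _
  have hg₀s (θ : T2) (i j : Fin 2) : g₀ θ i j = g₀ θ j i := by
    rw [← hiso, inducedMetric_symm]
  have hsum (p : Fin 2 × Fin 2) : Summable (sobolevTerm s (entries (g - g₀) p)) :=
    summable_sobolevTerm_sub (hg p).1 (hg p).2 (hg₀ p)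
  let h (i j : Fin 2) : Freq → ℂ :=
    UnitAddTorus.mFourierCoeff fun θ => (entries (g - g₀) (i, j) θ : ℂ)
  have hh (i j : Fin 2) : InWiener t (h i j) := (inWiener_and_wienerNorm_le hst (hsum (i, j))).1
  have hhD (i j : Fin 2) : wienerNorm t (h i j) ≤ L * n := by
    refine (inWiener_and_wienerNorm_le hst (hsum (i, j))).2.trans ?_
    exact mul_le_mul (by simp [hL_def]) (sqrt_tsum_le_normH s _ (i, j)) (Real.sqrt_nonneg _) hL.le
  have hsymm (i j : Fin 2) : h i j = h j i := by
    have : entries (g - g₀) (i, j) = entries (g - g₀) (j, i) := funext fun θ => by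
      simp only [entries, Pi.sub_apply, Matrix.sub_apply]
      rw [hg₀s θ i j, (hgs θ).apply j i]
    simp only [h, this]
  have hDε : L * n ≤ ε := by
    have := hgρ.trans (min_le_left _ _)
    rwa [le_div_iff₀ hL, mul_comm] at this
  have hD1 : R * C * L * n ≤ 1 := by
    have := hgρ.trans (min_le_right _ _)
    rwa [le_div_iff₀ (by positivity), mul_comm] at this
  obtain ⟨v, hv, hvh, hvn, hvg⟩ :=
    H h (L * n) hh (fun i j => isHermSeq_mFourierCoeff _) hsymm hhD hDε
  let c (a : Fin 5) (k : Freq) : ℂ := ξ a k + v a k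
  have hc (a : Fin 5) : InWiener t (c a) := (hξ a t).add (hv a)
  have hch (a : Fin 5) : IsHermSeq (c a) := (hξc.1 a).add (hvh a)
  have hc1 (a : Fin 5) : InWiener 1 (c a) := (hc a).mono ht
  let x : T2 → E5 := fun θ => WithLp.toLp 2 fun a => (synth (c a) θ).re
  have hx : HasCoeffs x c := ⟨hch, fun θ a => rfl⟩
  have hdiff (a : Fin 5) (θ : T2) : coords (x - x₀) a θ = (synth (v a) θ).re := by
    have e : coords (x - x₀) a θ = (synth (c a) θ).re - x₀ θ a := rfl
    rw [e, hξc.2, synth_add ((hξ a 0).summable_norm le_rfl) ((hv a).summable_norm ht0),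
      Complex.add_re, add_sub_cancel_left]
  -- One estimate serves both norms, because μ and μ + α are below δ = 2t.
  have hnorm (r : ℝ) (hr : r ≤ 2 * t) : normH r (coords (x - x₀)) ≤ R * C * L * n := by
    have := normH_le ht0 hr hv hvh hdiff (by positivity) hvn
    linarith
  refine ⟨x, hx.isC_two hc1, memH_of_inWiener ht0 (by linarith) hc hch fun a θ => hx.2 θ a,
    memH_of_inWiener ht0 (by linarith) hc hch fun a θ => hx.2 θ a, ?_,
    (hnorm μ (by linarith)).trans hD1, hnorm (μ + α) (by linarith)⟩
  have hae : ∀ i j : Fin 2, ∀ᵐ θ ∂torusMeasure, inducedMetric x θ i j = g θ i j := by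
    intro i j
    have hL2 : MeasureTheory.MemLp (entries (g - g₀) (i, j)) 2 torusMeasure :=
      (hg (i, j)).1.sub (memLp_of_continuous (hg₀ (i, j)).continuous)
    -- The metric of x equals g⁰ plus the Fourier series of h at every point; only the passage from
    -- that series back to g − g⁰ excludes a null set.
    filter_upwards [ae_eq_synth_mFourierCoeff hL2.ofReal ((hh i j).summable_norm ht0)] with θ hθ
    have e1 := hx.inducedMetric_eq hc1 i j θ
    rw [gradDot_add_self (fun a => hξ a 1) (fun a => (hv a).mono ht), hvg,
      ← hξc.inducedMetric_eq (fun a => hξ a 1), hiso] at e1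
    have e2 : ((entries (g - g₀) (i, j) θ : ℝ) : ℂ) = synth (h i j) θ := hθ
    rw [← e2] at e1
    have e3 : inducedMetric x θ i j = g₀ θ i j + entries (g - g₀) (i, j) θ := by
      exact_mod_cast e1
    rw [e3]
    simp [entries]
  filter_upwards [MeasureTheory.ae_all_iff.2 fun i => MeasureTheory.ae_all_iff.2 (hae i)] with θ hθ
  ext i j
  exact hθ i j
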